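/- **Setting.** Let $k\in\mathbb N$, and let $(G^{(n)})_{n\in I}$, with $I\subseteq\mathbb N$ infinite, be a sequence of simple $k$-regular graphs, $G^{(n)}$ having $n$ vertices. Let $k=\lambda_1^{(n)}\ge\lambda_2^{(n)}\ge\dots\ge\lambda_n^{(n)}$ be the eigenvalues of the adjacency matrix of $G^{(n)}$, and put $\lambda^{(n)}=\max\{\lambda_2^{(n)},|\lambda_n^{(n)}|\}$. The sequence is a $k$-regular *expander sequence* with parameter $\lambda$ if $\lambda:=\limsup_{n\to\infty,\,n\in I}\lambda^{(n)}<k$. *The third scheme.* The vertices of $G^{(n)}$ are bins, initially empty. Let $W_1,W_2$ be two independent non-backtracking random walks on $G^{(n)}$, each starting from a uniformly random vertex: the first step goes to a uniformly random neighbour, and every later step goes to a uniformly random neighbour of the current vertex other than the vertex just left. At each time $t=0,1,\dots,n-1$ one ball is placed into the less loaded of the two bins $W_1(t)$ and $W_2(t)$. Ties are broken arbitrarily but not randomly, that is, by a deterministic rule that may depend on $t$ and on the trajectories of both walks up to time $t$. The walks are never reset. The *maximum load* is the number of balls in the fullest bin after all $n$ balls have been placed. **Theorem.** For every $\alpha>0$,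 $k$ and $\lambda$ there are constants $\kappa=\kappa(\alpha,\lambda,k)>0$ and $C=C(\alpha,\lambda,k)$ such that the following holds. Let $(G^{(n)})_{n\in I}$ be a $k$-regular expander sequence with parameter $\lambda$ such that, for every $n\in I$, the girth of $G^{(n)}$ is at least $$2\left\lceil \alpha\,\frac{\log n}{\log\log n}\right\rceil+1 .$$ Then, with high probability, the maximum load of the third scheme on $G^{(n)}$ is less than $\kappa\log_2\log n+C$. That is, for every $\varepsilon>0$ and all sufficiently large $n\in I$ this bound holds with probability at least $1-\varepsilon$, whatever the tie-breaking rule. Here $\log$ is the natural logarithm. -/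

import Mathlib

open Filter MeasureTheory ProbabilityTheory
open scoped ENNReal

noncomputable section

/-- For a graph whose adjacency matrix has eigenvalues `λ₁ ≥ λ₂ ≥ ⋯ ≥ λₙ` (with multiplicity),
the number `max {λ₂, |λₙ|}`. (`eigenvalues₀` is Mathlib's decreasing list of eigenvalues,
indexed from `0`. The value on graphs with fewer than two vertices is irrelevant.) -/
def secondEigenvalue {V : Type*} [Fintype V] (G : SimpleGraph V) : ℝ := by
  classical
  exact
    if h : 2 ≤ Fintype.card V then
      max ((G.isHermitian_adjMatrix ℝ).eigenvalues₀ ⟨1, by omega⟩)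
        |(G.isHermitian_adjMatrix ℝ).eigenvalues₀ ⟨Fintype.card V - 1, by omega⟩|
    else 0

open Classical in
/-- `(G n)`, `n ∈ I`, is a `k`-regular expander sequence with parameter `lam`:
the graph `G n` has `n` vertices, `I` is an infinite index set (nothing is required of `G n`
for `n ∉ I`), and `lam = limsup max {λ₂, |λₙ|} < k`, the limit superior being over `n ∈ I`. -/
structure IsExpanderSequence (k : ℕ) (lam : ℝ) (I : Set ℕ)
    (G : (n : ℕ) → SimpleGraph (Fin n)) : Prop where
  infinite : I.Infinite
  regular : ∀ n ∈ I, (G n).IsRegularOfDegree k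
  limsup_eq : limsup (fun n => secondEigenvalue (G n)) (atTop ⊓ 𝓟 I) = lam
  lt_degree : lam < k

/-- The probability mass at `v` of the uniform distribution on the finite set `s`. -/
def uniformMass {V : Type*} (s : Set V) (v : V) : ℝ≥0∞ :=
  s.indicator (fun _ => (s.ncard : ℝ≥0∞)⁻¹) v

/-- `W` is (under `μ`) a non-backtracking random walk on the finite graph `G`, started at a uniform
random vertex: the first step goes to a uniform random neighbour, and each later step goes to a
uniform random neighbour of the current vertex other than the vertex just left, conditionally
on the whole past. -/
structure IsNonBacktrackingWalk {V Ω : Type*} [MeasurableSpace V] [MeasurableSpace Ω]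
    (G : SimpleGraph V) (μ : Measure Ω) (W : ℕ → Ω → V) : Prop where
  measurable : ∀ t, Measurable (W t)
  start : ∀ v, μ {ω | W 0 ω = v} = uniformMass Set.univ v
  first_step : ∀ u v,
    μ {ω | W 0 ω = u ∧ W 1 ω = v} = μ {ω | W 0 ω = u} * uniformMass (G.neighborSet u) v
  next_step : ∀ (t : ℕ) (p : ℕ → V) (v : V),
    μ {ω | (∀ s ≤ t + 1, W s ω = p s) ∧ W (t + 2) ω = v} =
      μ {ω | ∀ s ≤ t + 1, W s ω = p s} * uniformMass (G.neighborSet (p (t + 1)) \ {p t}) v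

/-- A deterministic rule for breaking ties at each time `t`: it may depend on the
trajectories of both walkers up to time `t`. `true` selects the first walker's bin. -/
abbrev TieRule (V : Type*) : Type _ := (t : ℕ) → (Fin (t + 1) → V × V) → Bool

/-- The bin that receives the ball of time `t`, given the loads `q` just before time `t`:
the less loaded one of `w₁ t` and `w₂ t`. -/
def chosenBin {V : Type*} (tie : TieRule V) (w₁ w₂ : ℕ → V) (t : ℕ) (q : V → ℕ) : V :=
  if q (w₁ t) < q (w₂ t) then w₁ t
  else if q (w₂ t) < q (w₁ t) then w₂ t
  else if tie t (fun s => (w₁ s, w₂ s)) then w₁ t else w₂ t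

open Classical in
/-- The load vector after the balls of times `0, …, t - 1` have been placed, when the two walkers
follow the trajectories `w₁` and `w₂`. -/
def load {V : Type*} (tie : TieRule V) (w₁ w₂ : ℕ → V) : ℕ → V → ℕ
  | 0 => fun _ => 0
  | t + 1 => fun v =>
      load tie w₁ w₂ t v + if v = chosenBin tie w₁ w₂ t (load tie w₁ w₂ t) then 1 else 0

/-- The load of the fullest bin after as many balls as there are bins have been placed. -/
def maxLoad {V : Type*} [Fintype V] (tie : TieRule V) (w₁ w₂ : ℕ → V) : ℕ :=
  Finset.univ.sup (load tie w₁ w₂ (Fintype.card V))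

end

/-! The proof is a layered induction on the load level, made to work for dependent choices by fast
mixing and by the rarity of returns.

An expander sequence has degree at least 3 (`IsExpanderSequence.three_le`): for degree at most 2
balls grow linearly, which is incompatible with a spectral gap on large graphs. For degree at least
3 a non-backtracking walk mixes: after `M = O(log n)` steps every vertex has conditional probability
at most `2/n` (`exists_nbProb_le`). The girth condition makes a return at any given later time have
conditional probability at most `δ = (1/2) ^ ρ`, where `ρ` is about `α log n / log log n`
(`IsNonBacktrackingWalk.walkBounds`). Only these two bounds and the independence of the walks,
collected in `WalkPair`, enter the rest.

A bin reaches level `i + 1` only when both walks are at bins of level at least `i`. Apart from the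
first `M` times, either one walk is at a vertex visited during the last `M` steps, or both bins
already had level `i` at time `t - M` (`card_heavyBins_succ_le`). The first alternative has
probability `O(M (δ + 1/n))`, the second one is of the order of the square of the fraction of bins
of level `i`. So this fraction is essentially squared at each level, and after about `log₂ log n`
levels only the error `ξ`, a constant multiple of `M (δ + 2/n)`, is left. Markov's inequality
suffices, since the thresholds can be chosen so that the failure probabilities form a geometric
series.

To go on from there, suppose that a bin gets more than `2r` further balls. Then one walk visits it
more than `r` times while the other walk is at a bin that is already heavy. Each further such visit
costs a factor `O(ξ)` (`WalkPair.sum_prob_hitChain_succ_le`), and `ξ` is as small as `exp (-Ω(log n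
/ log log n))`. Hence `r = O(log log n)` visits make the expected number of such chains tend to zero
(`WalkPair.prob_maxLoad_gt_le`, `eventually_exists_parameters`). -/

set_option linter.unusedSectionVars false

/-! ### The spectral gap as an operator bound on functions of mean zero -/

section Spectral

variable {V : Type*} {G : SimpleGraph V} {k : ℕ} {σ : ℝ}

open Classical in
/-- The entries of the adjacency matrix, as real numbers. -/
noncomputable def adjWeight (G : SimpleGraph V) (a b : V) : ℝ := if G.Adj a b then 1 else 0

lemma adjWeight_comm (G : SimpleGraph V) (a b : V) : adjWeight G a b = adjWeight G b a := by
  by_cases h : G.Adj a b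
  · simp [adjWeight, h, h.symm]
  · simp [adjWeight, h, mt SimpleGraph.Adj.symm h]

lemma adjWeight_nonneg (G : SimpleGraph V) (a b : V) : 0 ≤ adjWeight G a b := by
  unfold adjWeight; split_ifs <;> norm_num

lemma adjWeight_sq (G : SimpleGraph V) (a b : V) : adjWeight G a b ^ 2 = adjWeight G a b := by
  unfold adjWeight; split_ifs <;> norm_num

variable [Fintype V]

/-- The adjacency matrix as an operator on functions. -/
noncomputable def adjOp (G : SimpleGraph V) (φ : V → ℝ) (a : V) : ℝ := ∑ b, adjWeight G a b * φ b

/-- The adjacency operator has norm at most `σ` on functions with mean zero. -/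
def SpectralBound (G : SimpleGraph V) (σ : ℝ) : Prop :=
  ∀ φ : V → ℝ, ∑ a, φ a = 0 → ∑ a, adjOp G φ a ^ 2 ≤ σ ^ 2 * ∑ a, φ a ^ 2

lemma sum_adjWeight_of_regular [G.LocallyFinite] (h : G.IsRegularOfDegree k) (a : V) :
    ∑ b, adjWeight G a b = k := by
  classical
  rw [← h a, ← SimpleGraph.card_neighborFinset_eq_degree]
  simp only [adjWeight, Finset.sum_boole]
  congr 2
  ext b
  simp

lemma sum_adjOp_mul (φ ψ : V → ℝ) : ∑ a, adjOp G φ a * ψ a = ∑ a, φ a * adjOp G ψ a := by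
  simp only [adjOp, Finset.sum_mul, Finset.mul_sum]
  rw [Finset.sum_comm]
  refine Finset.sum_congr rfl fun a _ => Finset.sum_congr rfl fun b _ => ?_
  rw [adjWeight_comm G b a]; ring

lemma sum_adjOp (hk : ∀ a, ∑ b, adjWeight G a b = k) (φ : V → ℝ) :
    ∑ a, adjOp G φ a = k * ∑ a, φ a := by
  have h := sum_adjOp_mul (G := G) φ fun _ => 1
  simp only [mul_one] at h
  rw [h, Finset.mul_sum]
  refine Finset.sum_congr rfl fun a _ => ?_
  simp [adjOp, hk, mul_comm]

lemma adjOp_sq_le (hk : ∀ a, ∑ b, adjWeight G a b = k) (φ : V → ℝ) :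
    ∑ a, adjOp G φ a ^ 2 ≤ (k : ℝ) ^ 2 * ∑ a, φ a ^ 2 := by
  have h : ∀ a, adjOp G φ a ^ 2 ≤ k * ∑ b, adjWeight G a b * φ b ^ 2 := fun a => by
    have := Finset.sum_mul_sq_le_sq_mul_sq Finset.univ (fun b => adjWeight G a b)
      fun b => adjWeight G a b * φ b
    have e1 : ∀ b, adjWeight G a b * (adjWeight G a b * φ b) = adjWeight G a b * φ b := fun b => by
      rw [← mul_assoc, ← sq, adjWeight_sq]
    simp only [e1, mul_pow, adjWeight_sq, hk] at this
    exact this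
  refine (Finset.sum_le_sum fun a _ => h a).trans_eq ?_
  rw [← Finset.mul_sum, Finset.sum_comm, sq, mul_assoc]
  congr 1
  rw [Finset.mul_sum]
  refine Finset.sum_congr rfl fun b _ => ?_
  rw [← Finset.sum_mul]
  simp_rw [adjWeight_comm G _ b]
  rw [hk]

/-- The spectral theorem in coordinates, with Parseval's identity in place of the inner product
space. -/
lemma exists_adj_eigenbasis (G : SimpleGraph V) :
    ∃ (v : V → V → ℝ) (μ : V → ℝ), (∀ j a, adjOp G (v j) a = μ j * v j a) ∧
      (∀ j, ∑ a, v j a ^ 2 = 1) ∧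
      (∀ φ : V → ℝ, ∑ j, (∑ a, v j a * φ a) ^ 2 = ∑ a, φ a ^ 2) ∧
      (2 ≤ Fintype.card V → (∃ i, secondEigenvalue G ≤ |μ i|) ∧
        ∃ i₀, ∀ i ≠ i₀, |μ i| ≤ secondEigenvalue G) := by
  classical
  set hA := G.isHermitian_adjMatrix ℝ
  let e := Fintype.equivOfCardEq (Fintype.card_fin (Fintype.card V)) (β := V)
  refine ⟨fun j a => hA.eigenvectorBasis j a, hA.eigenvalues, fun j a => ?_, fun j => ?_,
    fun φ => ?_, fun h2 => ?_⟩
  · have h := congrFun (hA.mulVec_eigenvectorBasis j) a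
    rw [SimpleGraph.adjMatrix_mulVec_apply] at h
    simp only [Pi.smul_apply, smul_eq_mul] at h
    rw [← h]
    simp only [adjOp, adjWeight, ite_mul, one_mul, zero_mul]
    rw [← Finset.sum_filter]
    refine Finset.sum_congr ?_ fun _ _ => rfl
    ext b; simp
  · have h := hA.eigenvectorBasis.orthonormal.1 j
    rw [EuclideanSpace.norm_eq, Real.sqrt_eq_one] at h
    simpa using h
  · have h := hA.eigenvectorBasis.sum_sq_inner_right (WithLp.toLp 2 φ)
    rw [EuclideanSpace.norm_sq_eq] at h
    simp only [PiLp.inner_apply, Real.norm_eq_abs, sq_abs] at h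
    rw [← h]
    refine Finset.sum_congr rfl fun j _ => ?_
    congr 1
    simp [mul_comm]
  · have hs : secondEigenvalue G = max (hA.eigenvalues₀ ⟨1, by omega⟩)
        |hA.eigenvalues₀ ⟨Fintype.card V - 1, by omega⟩| := by
      simp only [secondEigenvalue, dif_pos h2]
    have he : ∀ i, hA.eigenvalues (e i) = hA.eigenvalues₀ i := fun i => by
      change hA.eigenvalues₀ (e.symm (e i)) = _
      rw [e.symm_apply_apply]
    constructor
    · rcases le_total (hA.eigenvalues₀ ⟨1, by omega⟩)
          |hA.eigenvalues₀ ⟨Fintype.card V - 1, by omega⟩| with h | h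
      · exact ⟨e ⟨Fintype.card V - 1, by omega⟩, by rw [hs, max_eq_right h, he]⟩
      · exact ⟨e ⟨1, by omega⟩, by rw [hs, max_eq_left h, he]; exact le_abs_self _⟩
    -- In a decreasing list, all entries after the first lie between the last entry and the second.
    · refine ⟨e ⟨0, by omega⟩, fun i hi => ?_⟩
      obtain ⟨j, rfl⟩ := e.surjective i
      have hj : j ≠ ⟨0, by omega⟩ := fun h => hi (by rw [h])
      have hj1 : 1 ≤ (j : ℕ) := by
        rcases Nat.eq_zero_or_pos j with h | h
        · exact absurd (Fin.ext h) hj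
        · exact h
      rw [he, hs, abs_le]
      have h1 := hA.eigenvalues₀_antitone (a := ⟨1, by omega⟩) (b := j) (by simpa [Fin.le_def])
      have h3 := hA.eigenvalues₀_antitone (a := j) (b := ⟨Fintype.card V - 1, by omega⟩)
        (by have := j.2; simp only [Fin.le_def]; omega)
      refine ⟨?_, h1.trans (le_max_left _ _)⟩
      have h4 := neg_abs_le (hA.eigenvalues₀ ⟨Fintype.card V - 1, by omega⟩)
      have h5 := le_max_right (hA.eigenvalues₀ ⟨1, by omega⟩)
        |hA.eigenvalues₀ ⟨Fintype.card V - 1, by omega⟩|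
      linarith

lemma secondEigenvalue_nonneg (G : SimpleGraph V) : 0 ≤ secondEigenvalue G := by
  unfold secondEigenvalue
  split_ifs
  · exact (abs_nonneg _).trans (le_max_right _ _)
  · exact le_rfl

lemma secondEigenvalue_le (hk : ∀ a, ∑ b, adjWeight G a b = k) : secondEigenvalue G ≤ k := by
  by_cases h2 : 2 ≤ Fintype.card V
  · obtain ⟨v, μ, hv, hn, -, h⟩ := exists_adj_eigenbasis G
    obtain ⟨⟨i, hi⟩, -⟩ := h h2
    refine hi.trans (abs_le_of_sq_le_sq ?_ (Nat.cast_nonneg k))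
    have := adjOp_sq_le hk (v i)
    simpa only [hv, mul_pow, ← Finset.mul_sum, hn, mul_one] using this
  · simp only [secondEigenvalue, dif_neg h2]; positivity

/-- As `σ < k`, all basis vectors other than the exceptional one have an eigenvalue different from
`k` and so are orthogonal to the constants. The exceptional one therefore spans the constants, and
functions of mean zero have no component along it. -/
lemma spectralBound_of_secondEigenvalue_le (hk : ∀ a, ∑ b, adjWeight G a b = k)
    (h2 : 2 ≤ Fintype.card V) (hσ : secondEigenvalue G ≤ σ) (hσk : σ < k) :
    SpectralBound G σ := by
  obtain ⟨v, μ, hv, hn, hp, h⟩ := exists_adj_eigenbasis G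
  obtain ⟨-, i₀, hi₀⟩ := h h2
  have hσ0 : 0 ≤ σ := (secondEigenvalue_nonneg G).trans hσ
  have hc : ∀ j φ, ∑ a, v j a * adjOp G φ a = μ j * ∑ a, v j a * φ a := fun j φ => by
    rw [← sum_adjOp_mul, Finset.mul_sum]
    refine Finset.sum_congr rfl fun a _ => ?_
    rw [hv]; ring
  have h1 : ∀ j ≠ i₀, ∑ a, v j a = 0 := fun j hj => by
    have h := hc j fun _ => 1
    simp only [adjOp, mul_one, hk, ← Finset.sum_mul] at h
    have hlt : μ j < k := (le_abs_self _).trans_lt ((hi₀ j hj).trans hσ |>.trans_lt hσk)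
    have : ((k : ℝ) - μ j) * ∑ a, v j a = 0 := by linarith
    rcases mul_eq_zero.1 this with h' | h'
    · linarith
    · exact h'
  intro φ hφ
  rw [← hp φ, ← hp, Finset.mul_sum]
  have hV : (0 : ℝ) < Fintype.card V := by exact_mod_cast (by omega : 0 < Fintype.card V)
  have hp1 := hp fun _ => 1
  simp only [mul_one, one_pow, Finset.sum_const, Finset.card_univ, nsmul_eq_mul] at hp1
  rw [Finset.sum_eq_single i₀ (fun j _ hj => by rw [h1 j hj]; simp) (by simp)] at hp1
  -- Polarization: comparing Parseval for `φ + 1`, `φ` and `1` isolates the cross term, in which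
  -- only the index `i₀` survives.
  have hpol := hp fun a => φ a + 1
  have hzero : ∑ a, v i₀ a * φ a = 0 := by
    have e1 : ∀ j, ∑ a, v j a * (φ a + 1) = (∑ a, v j a * φ a) + ∑ a, v j a := fun j => by
      rw [← Finset.sum_add_distrib]
      exact Finset.sum_congr rfl fun a _ => by ring
    have e2 : ∑ a, (φ a + 1) ^ 2 = ∑ a, φ a ^ 2 + Fintype.card V := by
      have : ∀ a, (φ a + 1) ^ 2 = φ a ^ 2 + 2 * φ a + 1 := fun a => by ring
      simp only [this, Finset.sum_add_distrib, ← Finset.mul_sum, hφ]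
      simp
    have e3 : ∀ j, ((∑ a, v j a * φ a) + ∑ a, v j a) ^ 2 = (∑ a, v j a * φ a) ^ 2 +
        2 * ((∑ a, v j a * φ a) * ∑ a, v j a) + (∑ a, v j a) ^ 2 := fun j => by ring
    rw [e2] at hpol
    simp only [e1, e3, Finset.sum_add_distrib, ← Finset.mul_sum, hp] at hpol
    rw [Finset.sum_eq_single (f := fun i => (∑ a, v i a * φ a) * ∑ a, v i a) i₀
        (fun j _ hj => by simp [h1 j hj]) (by simp),
      Finset.sum_eq_single (f := fun i => (∑ a, v i a) ^ 2) i₀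
        (fun j _ hj => by simp [h1 j hj]) (by simp), hp1] at hpol
    have h0 : (∑ a, v i₀ a * φ a) * ∑ a, v i₀ a = 0 := by linarith
    rcases mul_eq_zero.1 h0 with h' | h'
    · exact h'
    · rw [h'] at hp1; norm_num at hp1; linarith
  refine Finset.sum_le_sum fun j _ => ?_
  rw [hc, mul_pow]
  by_cases hj : j = i₀
  · rw [hj, hzero]; simp
  · refine mul_le_mul_of_nonneg_right ?_ (sq_nonneg _)
    exact sq_le_sq.2 (((hi₀ j hj).trans hσ).trans (le_abs_self _))

end Spectral

/-! ### Degree at most two is incompatible with a spectral gap -/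

section SmallDegree

variable {V : Type*} [Fintype V] {G : SimpleGraph V} {k : ℕ} {σ : ℝ}

open Classical in
lemma card_filter_adj (hk : ∀ a, ∑ b, adjWeight G a b = k) (a : V) :
    (Finset.univ.filter (G.Adj a)).card = k := by
  have := hk a
  simp only [adjWeight, Finset.sum_boole] at this
  exact_mod_cast this

open Classical in
/-- The ball of radius `m` around `v`. -/
noncomputable def ballFinset (G : SimpleGraph V) (v : V) : ℕ → Finset V
  | 0 => {v}
  | m + 1 => ballFinset G v m ∪ (ballFinset G v m).biUnion fun u => Finset.univ.filter (G.Adj u)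

/-- A vertex on a sphere of positive radius has a neighbour in the smaller ball, hence at most one
neighbour outside its own ball. So no sphere has more than two vertices. -/
lemma card_ballFinset_le (hk : ∀ a, ∑ b, adjWeight G a b = k) (hk2 : k ≤ 2) (v : V) (m : ℕ) :
    (ballFinset G v m).card ≤ 2 * m + 1 := by
  classical
  have hmono : ∀ m, ballFinset G v m ⊆ ballFinset G v (m + 1) := fun m => by
    rw [ballFinset]; exact Finset.subset_union_left
  have hN : ∀ m, ∀ u ∈ ballFinset G v m, ∀ w, G.Adj u w → w ∈ ballFinset G v (m + 1) :=
    fun m u hu w hw => by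
      rw [ballFinset]
      exact Finset.mem_union_right _ (Finset.mem_biUnion.2 ⟨u, hu, by simpa using hw⟩)
  have hsph : ∀ m, (ballFinset G v (m + 1) \ ballFinset G v m).card ≤ 2 := by
    intro m
    induction m with
    | zero =>
      refine (Finset.card_le_card (t := Finset.univ.filter (G.Adj v)) fun w hw => ?_).trans
        ((card_filter_adj hk v).le.trans hk2)
      simp only [ballFinset, Finset.mem_sdiff, Finset.mem_union, Finset.mem_singleton,
        Finset.mem_biUnion, Finset.mem_filter, Finset.mem_univ, true_and] at hw ⊢
      obtain ⟨h | ⟨u, rfl, h⟩, h2⟩ := hw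
      · exact absurd h h2
      · exact h
    | succ m ih =>
      refine le_trans (Finset.card_le_card (t := (ballFinset G v (m + 1) \
        ballFinset G v m).biUnion fun u => Finset.univ.filter (G.Adj u) \
          ballFinset G v (m + 1)) fun w hw => ?_) (Finset.card_biUnion_le.trans ?_)
      · rw [Finset.mem_sdiff] at hw
        obtain ⟨hw1, hw2⟩ := hw
        rw [ballFinset, Finset.mem_union, Finset.mem_biUnion] at hw1
        obtain h | ⟨u, hu, h⟩ := hw1
        · exact absurd h hw2
        · refine Finset.mem_biUnion.2 ⟨u, Finset.mem_sdiff.2 ⟨hu, fun hu' => hw2 ?_⟩,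
            Finset.mem_sdiff.2 ⟨h, hw2⟩⟩
          exact hN m u hu' w (by simpa using h)
      · refine le_trans (Finset.sum_le_sum (g := fun _ => 1) fun u hu => ?_) (by simpa using ih)
        rw [Finset.mem_sdiff] at hu
        have hu1 := hu.1
        rw [ballFinset, Finset.mem_union, Finset.mem_biUnion] at hu1
        obtain h | ⟨x, hx, h⟩ := hu1
        · exact absurd h hu.2
        · have hlt : (Finset.univ.filter (G.Adj u) \ ballFinset G v (m + 1)).card <
              (Finset.univ.filter (G.Adj u)).card := by
            refine Finset.card_lt_card (Finset.ssubset_iff_of_subset Finset.sdiff_subset |>.2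
              ⟨x, ?_, fun hx' => (Finset.mem_sdiff.1 hx').2 (hmono m hx)⟩)
            simpa using (show G.Adj x u by simpa using h).symm
          have := card_filter_adj hk u
          omega
  induction m with
  | zero => simp [ballFinset]
  | succ m ih =>
    have h1 := Finset.card_sdiff_add_card_eq_card (hmono m)
    have h2 := hsph m
    omega

lemma iterate_adjOp_eq_zero (v : V) (φ : V → ℝ) (hφ : ∀ a ≠ v, φ a = 0) (m : ℕ) :
    ∀ a ∉ ballFinset G v m, (adjOp G)^[m] φ a = 0 := by
  classical
  induction m with
  | zero => intro a ha; exact hφ a (by simpa [ballFinset] using ha)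
  | succ m ih =>
    intro a ha
    rw [Function.iterate_succ_apply', adjOp]
    refine Finset.sum_eq_zero fun b _ => ?_
    by_cases hb : b ∈ ballFinset G v m
    · have : ¬ G.Adj a b := fun hab => ha <| by
        rw [ballFinset]
        exact Finset.mem_union_right _ (Finset.mem_biUnion.2 ⟨b, hb, by simpa using hab.symm⟩)
      simp [adjWeight, this]
    · rw [ih b hb, mul_zero]

lemma sum_iterate_adjOp (hk : ∀ a, ∑ b, adjWeight G a b = k) (φ : V → ℝ) (m : ℕ) :
    ∑ a, (adjOp G)^[m] φ a = (k : ℝ) ^ m * ∑ a, φ a := by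
  induction m with
  | zero => simp
  | succ m ih => rw [Function.iterate_succ_apply', sum_adjOp hk, ih]; ring

lemma SpectralBound.iterate (h : SpectralBound G σ) (hk : ∀ a, ∑ b, adjWeight G a b = k)
    (φ : V → ℝ) (hφ : ∑ a, φ a = 0) (m : ℕ) :
    ∑ a, (adjOp G)^[m] φ a ^ 2 ≤ (σ ^ 2) ^ m * ∑ a, φ a ^ 2 := by
  induction m with
  | zero => simp
  | succ m ih =>
    rw [Function.iterate_succ_apply']
    refine (h _ (by rw [sum_iterate_adjOp hk, hφ, mul_zero])).trans ?_
    rw [pow_succ' (σ ^ 2) m, mul_assoc]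
    exact mul_le_mul_of_nonneg_left ih (sq_nonneg _)

lemma iterate_adjOp_add_const (hk : ∀ a, ∑ b, adjWeight G a b = k) (φ : V → ℝ) (c : ℝ) (m : ℕ) :
    (adjOp G)^[m] (fun a => φ a + c) = fun a => (adjOp G)^[m] φ a + (k : ℝ) ^ m * c := by
  induction m with
  | zero => simp
  | succ m ih =>
    rw [Function.iterate_succ_apply', ih, Function.iterate_succ_apply']
    funext a
    simp only [adjOp, mul_add, Finset.sum_add_distrib, ← Finset.sum_mul, hk]
    ring

/-- Apply the `m`-th power of the adjacency operator to a point mass. The result has total mass `k ^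
m` and lives on a ball of at most `2 * m + 1` points, so Cauchy–Schwarz bounds its norm from below.
The spectral bound, applied after subtracting the mean, bounds it from above. -/
lemma SpectralBound.pow_le (h : SpectralBound G σ) (hk : ∀ a, ∑ b, adjWeight G a b = k)
    (hk2 : k ≤ 2) (hV : 0 < Fintype.card V) (m : ℕ) :
    ((k : ℝ) ^ 2) ^ m ≤ (2 * m + 1) * ((σ ^ 2) ^ m + ((k : ℝ) ^ 2) ^ m / Fintype.card V) := by
  classical
  obtain ⟨v⟩ := Fintype.card_pos_iff.1 hV
  have hn : (0 : ℝ) < Fintype.card V := by exact_mod_cast hV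
  set n : ℝ := (Fintype.card V : ℝ) with hndef
  set φ : V → ℝ := fun a => (if a = v then 1 else 0) - 1 / n
  have hφ : ∑ a, φ a = 0 := by
    simp [φ, Finset.sum_sub_distrib]
    field_simp
    simp [n]
  have hφ2 : ∑ a, φ a ^ 2 ≤ 1 := by
    have e : ∀ a, φ a ^ 2 = (if a = v then 1 else 0) - 2 / n * φ a - 1 / n ^ 2 := fun a => by
      simp only [φ]; split_ifs <;> ring
    simp only [e, Finset.sum_sub_distrib, ← Finset.mul_sum, hφ]
    simp
    positivity
  set e : V → ℝ := fun a => φ a + 1 / n with he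
  have he' : ∀ a ≠ v, e a = 0 := fun a ha => by simp [e, φ, ha]
  have hes : ∑ a, e a = 1 := by simp [e, φ]
  have hsum := sum_iterate_adjOp hk e m
  rw [hes, mul_one] at hsum
  have hsupp := iterate_adjOp_eq_zero (G := G) v e he' m
  have hrestr : ∑ a ∈ ballFinset G v m, (adjOp G)^[m] e a = (k : ℝ) ^ m := by
    rw [← hsum]
    exact Finset.sum_subset (Finset.subset_univ _) fun a _ ha => hsupp a ha
  have hcs := sq_sum_le_card_mul_sum_sq (s := ballFinset G v m) (f := (adjOp G)^[m] e)
  rw [hrestr] at hcs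
  have hle : ∑ a ∈ ballFinset G v m, (adjOp G)^[m] e a ^ 2 ≤ ∑ a, (adjOp G)^[m] e a ^ 2 :=
    Finset.sum_le_sum_of_subset_of_nonneg (Finset.subset_univ _) fun _ _ _ => sq_nonneg _
  have hnorm : ∑ a, (adjOp G)^[m] e a ^ 2 ≤ (σ ^ 2) ^ m + ((k : ℝ) ^ 2) ^ m / n := by
    have h1 := h.iterate hk φ hφ m
    have h2 := sum_iterate_adjOp hk φ m
    rw [hφ, mul_zero] at h2
    have e1 : ∀ a, (adjOp G)^[m] e a ^ 2 = (adjOp G)^[m] φ a ^ 2 +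
        2 * ((k : ℝ) ^ m * (1 / n)) * (adjOp G)^[m] φ a + ((k : ℝ) ^ 2) ^ m * (1 / n ^ 2) :=
      fun a => by rw [he, iterate_adjOp_add_const hk]; ring
    simp only [e1, Finset.sum_add_distrib, ← Finset.mul_sum, h2]
    have e2 : ∑ _a : V, 1 / n ^ 2 = 1 / n := by
      rw [Finset.sum_const, Finset.card_univ, nsmul_eq_mul]
      change n * (1 / n ^ 2) = _
      field_simp
    rw [e2]
    have : (σ ^ 2) ^ m * ∑ a, φ a ^ 2 ≤ (σ ^ 2) ^ m * 1 :=
      mul_le_mul_of_nonneg_left hφ2 (by positivity)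
    linarith [div_eq_mul_one_div (((k : ℝ) ^ 2) ^ m) n]
  have hcard : ((ballFinset G v m).card : ℝ) ≤ 2 * m + 1 := by
    exact_mod_cast card_ballFinset_le hk hk2 v m
  calc ((k : ℝ) ^ 2) ^ m = ((k : ℝ) ^ m) ^ 2 := by ring
    _ ≤ _ := hcs
    _ ≤ _ := mul_le_mul hcard (hle.trans hnorm) (Finset.sum_nonneg fun _ _ => sq_nonneg _)
      (by positivity)

/-- Expanders have degree at least three. -/
lemma exists_card_le_of_spectralBound (hk1 : 1 ≤ k) (hk2 : k ≤ 2) (hσ0 : 0 ≤ σ) (hσ : σ < k) :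
    ∃ N : ℕ, ∀ {V : Type*} [Fintype V] {G : SimpleGraph V}, (∀ a, ∑ b, adjWeight G a b = k) →
      SpectralBound G σ → Fintype.card V ≤ N := by
  have hk0 : (0 : ℝ) < k := by exact_mod_cast hk1
  set r : ℝ := σ ^ 2 / (k : ℝ) ^ 2 with hr
  have hr0 : 0 ≤ r := by positivity
  have hr1 : r < 1 := by
    rw [hr, div_lt_one (by positivity)]
    exact pow_lt_pow_left₀ hσ hσ0 two_ne_zero
  have ht : Tendsto (fun m : ℕ => 2 * ((m : ℝ) * r ^ m) + r ^ m) atTop (nhds (2 * 0 + 0)) :=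
    ((tendsto_self_mul_const_pow_of_lt_one hr0 hr1).const_mul 2).add
      (tendsto_pow_atTop_nhds_zero_of_lt_one hr0 hr1)
  -- With `(2 * m + 1) * r ^ m < 1 / 2`, the first term of `SpectralBound.pow_le` is less than half
  -- of the left side. More than `2 * (2 * m + 1)` vertices would make the second term at most half
  -- of it as well.
  obtain ⟨m, hm⟩ := (ht.eventually (gt_mem_nhds (show (2 * 0 + 0 : ℝ) < 1 / 2 by norm_num))).exists
  refine ⟨2 * (2 * m + 1), fun {V} _ {G} hG hS => ?_⟩
  by_contra! hlt
  have h := hS.pow_le hG hk2 (by omega) m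
  have hK : (0 : ℝ) < ((k : ℝ) ^ 2) ^ m := by positivity
  have hn : (2 * (2 * m + 1) : ℝ) < Fintype.card V := by exact_mod_cast hlt
  have hrm : (σ ^ 2) ^ m = r ^ m * ((k : ℝ) ^ 2) ^ m := by
    rw [hr, div_pow]; field_simp
  have h1 : ((k : ℝ) ^ 2) ^ m / Fintype.card V * (2 * m + 1) ≤ ((k : ℝ) ^ 2) ^ m * (1 / 2) := by
    rw [div_mul_eq_mul_div, div_le_iff₀ (by linarith [m.cast_nonneg (α := ℝ)])]
    nlinarith
  rw [hrm] at h
  nlinarith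

end SmallDegree

/-! ### Mixing of non-backtracking walks -/

section Mixing

variable {V : Type*} [Fintype V] {G : SimpleGraph V} {k : ℕ} {σ : ℝ}

/-- The sum of `f` over the edges leaving `a`. -/
noncomputable def outSum (G : SimpleGraph V) (f : V → V → ℝ) (a : V) : ℝ :=
  ∑ b, adjWeight G a b * f a b

/-- The non-backtracking operator on functions of directed edges. -/
noncomputable def nbOp (G : SimpleGraph V) (f : V → V → ℝ) (a b : V) : ℝ :=
  outSum G f b - adjWeight G b a * f b a

/-- The squared norm of a function of directed edges. -/
noncomputable def edgeEnergy (G : SimpleGraph V) (f : V → V → ℝ) : ℝ :=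
  ∑ a, ∑ b, adjWeight G a b * f a b ^ 2

lemma edgeEnergy_nonneg (f : V → V → ℝ) : 0 ≤ edgeEnergy G f :=
  Finset.sum_nonneg fun _ _ => Finset.sum_nonneg fun _ _ =>
    mul_nonneg (adjWeight_nonneg _ _ _) (sq_nonneg _)

lemma sq_le_edgeEnergy {a b : V} (hab : G.Adj a b) (f : V → V → ℝ) :
    f a b ^ 2 ≤ edgeEnergy G f := by
  have h1 : f a b ^ 2 = adjWeight G a b * f a b ^ 2 := by simp [adjWeight, hab]
  rw [h1]
  have hn : ∀ a b, 0 ≤ adjWeight G a b * f a b ^ 2 := fun a b =>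
    mul_nonneg (adjWeight_nonneg _ _ _) (sq_nonneg _)
  exact (Finset.single_le_sum (fun b _ => hn a b) (Finset.mem_univ b)).trans
    (Finset.single_le_sum (f := fun a => ∑ b, adjWeight G a b * f a b ^ 2)
      (fun a _ => Finset.sum_nonneg fun b _ => hn a b) (Finset.mem_univ a))

lemma nbOp_congr {f f' : V → V → ℝ} (h : ∀ a b, G.Adj a b → f a b = f' a b) :
    nbOp G f = nbOp G f' := by
  have h' : ∀ a b, adjWeight G a b * f a b = adjWeight G a b * f' a b := fun a b => by
    by_cases hab : G.Adj a b
    · rw [h a b hab]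
    · simp [adjWeight, hab]
  funext a b
  simp only [nbOp, outSum, h']

lemma sum_sum_comm_adj (F : V → V → ℝ) :
    ∑ a, ∑ b, adjWeight G a b * F b a = ∑ a, ∑ b, adjWeight G a b * F a b := by
  rw [Finset.sum_comm]
  exact Finset.sum_congr rfl fun a _ => Finset.sum_congr rfl fun b _ => by rw [adjWeight_comm]

lemma sum_sum_adj_right (hk : ∀ a, ∑ b, adjWeight G a b = k) (F : V → ℝ) :
    ∑ a, ∑ b, adjWeight G a b * F b = k * ∑ b, F b := by
  rw [sum_sum_comm_adj (fun a _ => F a)]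
  simp only [← Finset.sum_mul, hk, Finset.mul_sum]

lemma sum_outSum_nbOp (hk : ∀ a, ∑ b, adjWeight G a b = k) (f : V → V → ℝ) :
    ∑ a, outSum G (nbOp G f) a = (k - 1) * ∑ a, outSum G f a := by
  have e : ∀ a b, adjWeight G a b * nbOp G f a b =
      adjWeight G a b * outSum G f b - adjWeight G a b * f b a := fun a b => by
    rw [nbOp, adjWeight_comm G b a, mul_sub, ← mul_assoc, ← sq, adjWeight_sq]
  have : ∑ a, outSum G (nbOp G f) a = ∑ a, ∑ b, adjWeight G a b * nbOp G f a b := rfl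
  rw [this]
  simp only [e, Finset.sum_sub_distrib]
  rw [sum_sum_adj_right hk, sum_sum_comm_adj f]
  have : ∑ a, ∑ b, adjWeight G a b * f a b = ∑ a, outSum G f a := rfl
  rw [this]; ring

/-- Expand the square over the edges at `b`. Since the vertex sums can be as large as Cauchy–Schwarz
allows, a single step may multiply the energy by the full `(k - 1) ^ 2`; a gain appears only over
two steps. -/
lemma edgeEnergy_nbOp (hk : ∀ a, ∑ b, adjWeight G a b = k) (f : V → V → ℝ) :
    edgeEnergy G (nbOp G f) = (k - 2) * ∑ b, outSum G f b ^ 2 + edgeEnergy G f := by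
  have e : ∀ a b, adjWeight G a b * nbOp G f a b ^ 2 =
      adjWeight G a b * outSum G f b ^ 2 - 2 * (adjWeight G a b * (outSum G f b * f b a))
        + adjWeight G a b * f b a ^ 2 := fun a b => by
    have h := adjWeight_sq G a b
    rw [nbOp, adjWeight_comm G b a]
    linear_combination (adjWeight G a b * f b a ^ 2 + f b a ^ 2 - 2 * outSum G f b * f b a) * h
  rw [edgeEnergy]
  simp only [e, Finset.sum_sub_distrib, Finset.sum_add_distrib, ← Finset.mul_sum]
  rw [sum_sum_adj_right hk, sum_sum_comm_adj (fun a b => f a b ^ 2),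
    sum_sum_comm_adj (fun a b => outSum G f a * f a b)]
  have : ∀ a, ∑ b, adjWeight G a b * (outSum G f a * f a b) = outSum G f a ^ 2 := fun a => by
    rw [sq]
    nth_rw 2 [outSum]
    rw [Finset.sum_mul]
    exact Finset.sum_congr rfl fun b _ => by ring
  simp only [this]
  rw [edgeEnergy]; ring

lemma sum_weighted_sq_le (hk : ∀ a, ∑ b, adjWeight G a b = k) (u : V → ℝ) (a : V) :
    (∑ b, adjWeight G a b * u b) ^ 2 ≤ k * ∑ b, adjWeight G a b * u b ^ 2 := by
  have := Finset.sum_mul_sq_le_sq_mul_sq Finset.univ (fun b => adjWeight G a b)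
    fun b => adjWeight G a b * u b
  have e1 : ∀ b, adjWeight G a b * (adjWeight G a b * u b) = adjWeight G a b * u b := fun b => by
    rw [← mul_assoc, ← sq, adjWeight_sq]
  simpa only [e1, mul_pow, adjWeight_sq, hk] using this

lemma sum_outSum_sq_le (hk : ∀ a, ∑ b, adjWeight G a b = k) (f : V → V → ℝ) :
    ∑ a, outSum G f a ^ 2 ≤ k * edgeEnergy G f := by
  rw [edgeEnergy, Finset.mul_sum]
  exact Finset.sum_le_sum fun a _ => sum_weighted_sq_le hk (f a) a

/-- Split `f b ·` into its average `g b / k` and a fluctuation `r`. The average is moved by the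
adjacency operator, where the spectral gap acts; the fluctuation is controlled by the defect in
Cauchy–Schwarz. The parameter `τ` weights the two parts in Young's inequality. -/
lemma sum_outSum_nbOp_sq_le (hk : ∀ a, ∑ b, adjWeight G a b = k) (hk0 : 0 < k)
    (hS : SpectralBound G σ) {τ : ℝ} (hτ : 0 < τ) (f : V → V → ℝ) (hf : ∑ a, outSum G f a = 0) :
    ∑ a, outSum G (nbOp G f) a ^ 2 ≤
      (1 + τ) * ((k - 1) / k) ^ 2 * (σ ^ 2 * ∑ a, outSum G f a ^ 2) +
        (1 + 1 / τ) * (k * edgeEnergy G f - ∑ a, outSum G f a ^ 2) := by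
  have hK : (k : ℝ) ≠ 0 := by exact_mod_cast hk0.ne'
  set g := outSum G f
  set r : V → ℝ := fun a => ∑ b, adjWeight G a b * (f b a - g b / k)
  have h1 : ∀ a, outSum G (nbOp G f) a = ((k - 1) / k) * adjOp G g a - r a := fun a => by
    have e : ∀ b, adjWeight G a b * nbOp G f a b = ((k - 1) / k) * (adjWeight G a b * g b) -
        adjWeight G a b * (f b a - g b / k) := fun b => by
      have h := adjWeight_sq G a b
      rw [nbOp, adjWeight_comm G b a]
      change adjWeight G a b * (g b - _) = _
      field_simp
      linear_combination (-f b a * k) * h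
    simp only [outSum, e, Finset.sum_sub_distrib, ← Finset.mul_sum]
    rfl
  have h2 : ∑ a, r a ^ 2 ≤ k * edgeEnergy G f - ∑ a, g a ^ 2 := by
    refine (Finset.sum_le_sum fun a _ => sum_weighted_sq_le hk (fun b => f b a - g b / k) a).trans ?_
    rw [← Finset.mul_sum, sum_sum_comm_adj (fun b a => (f b a - g b / k) ^ 2)]
    have e : ∀ a b, adjWeight G a b * (f a b - g a / k) ^ 2 = adjWeight G a b * f a b ^ 2 -
        2 * (g a / k) * (adjWeight G a b * f a b) + (g a / k) ^ 2 * adjWeight G a b := fun a b => by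
      ring
    simp only [e, Finset.sum_sub_distrib, Finset.sum_add_distrib, ← Finset.mul_sum, hk]
    have e2 : ∑ a, 2 * (g a / k) * ∑ b, adjWeight G a b * f a b = 2 / k * ∑ a, g a ^ 2 := by
      rw [Finset.mul_sum]
      refine Finset.sum_congr rfl fun a _ => ?_
      change 2 * (g a / k) * g a = _
      ring
    have e3 : ∑ a, (g a / k) ^ 2 * (k : ℝ) = 1 / k * ∑ a, g a ^ 2 := by
      rw [Finset.mul_sum]
      refine Finset.sum_congr rfl fun a _ => ?_
      field_simp
    rw [e2, e3]
    have : (k : ℝ) * (∑ a, ∑ b, adjWeight G a b * f a b ^ 2 - 2 / k * ∑ a, g a ^ 2 +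
        1 / k * ∑ a, g a ^ 2) = k * edgeEnergy G f - ∑ a, g a ^ 2 := by
      rw [edgeEnergy]; field_simp; ring
    exact this.le
  have h3 : ∀ a, outSum G (nbOp G f) a ^ 2 ≤
      (1 + τ) * ((k - 1) / k) ^ 2 * adjOp G g a ^ 2 + (1 + 1 / τ) * r a ^ 2 := fun a => by
    rw [h1]
    set x := ((k - 1) / k : ℝ) * adjOp G g a with hx
    have : (x - r a) ^ 2 + (τ * x + r a) ^ 2 / τ = (1 + τ) * x ^ 2 + (1 + 1 / τ) * r a ^ 2 := by
      field_simp; ring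
    have h4 : 0 ≤ (τ * x + r a) ^ 2 / τ := by positivity
    rw [mul_assoc, ← mul_pow, ← hx]
    linarith
  refine (Finset.sum_le_sum fun a _ => h3 a).trans ?_
  rw [Finset.sum_add_distrib, ← Finset.mul_sum, ← Finset.mul_sum]
  have h5 := hS g hf
  have : 0 ≤ (1 + τ) * (((k : ℝ) - 1) / k) ^ 2 := by positivity
  have : 0 ≤ 1 + 1 / τ := by positivity
  gcongr

/-- The left side is affine in `Y`, and the hypotheses `hA` and `hB` are the cases `Y = E * N` and
`Y = 0`. -/
lemma interpolation_le {A E T Y N : ℝ} (hE : 0 < E) (hA : A * E + 1 ≤ T) (hB : 2 * E + 1 ≤ T)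
    (hY : 0 ≤ Y) (hYN : Y ≤ E * N) : A * Y + 2 * (E * N - Y) + N ≤ T * N := by
  obtain ⟨y, rfl⟩ : ∃ y, Y = E * y := ⟨Y / E, by field_simp⟩
  have hy0 : 0 ≤ y := le_of_mul_le_mul_left (by simpa using hY) hE
  have hyN : y ≤ N := le_of_mul_le_mul_left hYN hE
  linarith [mul_le_mul_of_nonneg_right hA hy0, mul_le_mul_of_nonneg_right hB (sub_nonneg.2 hyN)]

/-- Here `N` is the energy, `X` and `H` are the squared norms of the vertex sums before and after
one step, and `(k - 2) * (H + X) + N` is the energy after two steps. If `X` is close to its maximum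
`k * N`, the spectral bound on `H` gains; if `X` is small, the first step has already gained. -/
lemma exists_contraction_const {k σ : ℝ} (hk : 3 ≤ k) (hσ0 : 0 ≤ σ) (hσ : σ < k) :
    ∃ τ θ : ℝ, 0 < τ ∧ 0 < θ ∧ θ < 1 ∧ ∀ N X H : ℝ, 0 ≤ N → 0 ≤ X → X ≤ k * N →
      H ≤ (1 + τ) * ((k - 1) / k) ^ 2 * (σ ^ 2 * X) + (1 + 1 / τ) * (k * N - X) →
      H ≤ k * ((k - 2) * X + N) →
      (k - 2) * (H + X) + N ≤ θ * ((k - 1) ^ 2) ^ 2 * N := by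
  set μ := (σ / k) ^ 2 with hμ
  have hμ0 : 0 ≤ μ := by positivity
  have hμ1 : μ < 1 := by
    rw [hμ, sq_lt_one_iff₀ (by positivity), div_lt_one (by linarith)]; exact hσ
  -- Small enough that `(1 + τ) * μ < 1`, which leaves the gain `η`.
  set τ := (1 - μ) / 2 with hτ
  have hτ0 : 0 < τ := by linarith
  have hτ1 : τ ≤ 1 := by linarith
  set η := 1 - (1 + τ) * μ with hη
  have hη0 : 0 < η := by rw [hη, hτ]; nlinarith
  have hη1 : η ≤ 1 := by rw [hη]; nlinarith
  set D := (k - 1) ^ 2 with hD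
  have hD4 : 4 ≤ D := by nlinarith
  have hkD : (k - 2) * k = D - 1 := by rw [hD]; ring
  have hτη : τ * η ≤ 1 := by nlinarith
  have hτη0 : 0 < τ * η := by positivity
  -- The two values serve the two ends `X = k * N` and `X = 0`; for the latter `1 / 2` suffices
  -- because `D ≥ 4`.
  set θ := max (1 - (D - 1) * τ * η / D) (1 / 2) with hθ
  have hθ1 : 1 - (D - 1) * τ * η / D ≤ θ := le_max_left _ _
  have hθ2 : 1 / 2 ≤ θ := le_max_right _ _
  refine ⟨τ, θ, hτ0, by linarith, max_lt ?_ (by norm_num), ?_⟩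
  · have : 0 < (D - 1) * τ * η / D := by
      have : 0 < D - 1 := by linarith
      positivity
    linarith
  intro N X H hN hX hXN h1 h2
  have hk0 : 0 < k := by linarith
  have hσμ : σ ^ 2 = μ * k ^ 2 := by rw [hμ]; field_simp
  have h1' : H ≤ (1 + τ) * D * μ * X + (1 + 1 / τ) * (k * N - X) := by
    refine h1.trans_eq ?_
    rw [hσμ, hD]; field_simp
  -- The convex combination with weights `τ` and `1 - τ` cancels the large factor `1 / τ` in the
  -- first bound.
  have hH : H ≤ τ * ((1 + τ) * D * μ * X + (1 + 1 / τ) * (k * N - X)) +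
      (1 - τ) * (k * ((k - 2) * X + N)) := by
    linarith [mul_le_mul_of_nonneg_left h1' hτ0.le,
      mul_le_mul_of_nonneg_left h2 (sub_nonneg.2 hτ1)]
  have hH' : H ≤ τ * ((1 + τ) * μ) * D * X + (τ + 1) * (k * N - X) +
      (1 - τ) * ((D - 1) * X + k * N) := by
    refine hH.trans_eq ?_
    rw [← hkD]; field_simp
  have hH2 : H ≤ D * (1 - τ * η) * X + 2 * (k * N - X) := by
    refine hH'.trans_eq ?_
    have : (1 + τ) * μ = 1 - η := by rw [hη]; ring
    rw [this]; ring
  have hmain : (k - 2) * (H + X) + N ≤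
      (D * (1 - τ * η) + 1) * ((k - 2) * X) + 2 * (k - 2) * (k * N - X) + N := by
    linarith [mul_le_mul_of_nonneg_left hH2 (by linarith : 0 ≤ k - 2)]
  set Y := (k - 2) * X
  have hY0 : 0 ≤ Y := mul_nonneg (by linarith) hX
  have hYN : Y ≤ (D - 1) * N := by
    have := mul_le_mul_of_nonneg_left hXN (by linarith : 0 ≤ k - 2)
    rw [← mul_assoc, hkD] at this; exact this
  have hmain2 : (k - 2) * (H + X) + N ≤
      (D * (1 - τ * η) + 1) * Y + 2 * ((D - 1) * N - Y) + N := by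
    refine hmain.trans_eq ?_
    rw [← hkD]; ring
  refine hmain2.trans ?_
  have hθD : D ^ 2 - (D - 1) * τ * η * D ≤ θ * D ^ 2 := by
    have := mul_le_mul_of_nonneg_right hθ1 (sq_nonneg D)
    refine le_trans (le_of_eq ?_) this
    field_simp
  have hB : 2 * (D - 1) + 1 ≤ θ * D ^ 2 := by nlinarith
  have hA : (D * (1 - τ * η) + 1) * (D - 1) + 1 ≤ θ * D ^ 2 := by
    refine le_trans (le_of_eq ?_) hθD; ring
  have hD1 : 0 < D - 1 := by linarith
  exact interpolation_le hD1 hA hB hY0 hYN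

lemma exists_edgeEnergy_contraction (hk3 : 3 ≤ k) (hσ0 : 0 ≤ σ) (hσ : σ < k) :
    ∃ θ : ℝ, 0 < θ ∧ θ < 1 ∧ ∀ {V : Type*} [Fintype V] {G : SimpleGraph V},
      (∀ a, ∑ b, adjWeight G a b = k) → SpectralBound G σ →
      ∀ f : V → V → ℝ, ∑ a, outSum G f a = 0 →
        edgeEnergy G (nbOp G (nbOp G f)) ≤ θ * (((k : ℝ) - 1) ^ 2) ^ 2 * edgeEnergy G f := by
  obtain ⟨τ, θ, hτ, hθ0, hθ1, h⟩ :=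
    exists_contraction_const (k := k) (by exact_mod_cast hk3) hσ0 hσ
  refine ⟨θ, hθ0, hθ1, fun {V} _ {G} hk hS f hf => ?_⟩
  rw [edgeEnergy_nbOp hk, edgeEnergy_nbOp hk, ← add_assoc, ← mul_add]
  refine h _ _ _ (edgeEnergy_nonneg f) (Finset.sum_nonneg fun _ _ => sq_nonneg _)
    (sum_outSum_sq_le hk f) (sum_outSum_nbOp_sq_le hk (by omega) hS hτ f hf) ?_
  rw [← edgeEnergy_nbOp hk]
  exact sum_outSum_sq_le hk _

open Classical in
/-- The probability that a non-backtracking walk on a `k`-regular graph which has just crossed the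
edge from `a` to `b` is at `v` after `s` further steps. -/
noncomputable def nbProb (G : SimpleGraph V) (k s : ℕ) (a b v : V) : ℝ :=
  (nbOp G)^[s] (fun _ b => if b = v then 1 else 0) a b / ((k : ℝ) - 1) ^ s

open Classical in
lemma nbOp_eq_sum (f : V → V → ℝ) (a b : V) :
    nbOp G f a b = ∑ c, adjWeight G b c * if c = a then 0 else f b c := by
  have e : ∀ c, (adjWeight G b c * if c = a then 0 else f b c) =
      adjWeight G b c * f b c - if c = a then adjWeight G b c * f b c else 0 := fun c => by
    split_ifs <;> simp
  simp only [e, Finset.sum_sub_distrib, Finset.sum_ite_eq', Finset.mem_univ, if_true]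
  rfl

open Classical in
lemma nbProb_zero (a b v : V) : nbProb G k 0 a b v = if b = v then 1 else 0 := by
  simp [nbProb]

open Classical in
lemma nbProb_succ (s : ℕ) (a b v : V) : nbProb G k (s + 1) a b v =
    ((k : ℝ) - 1)⁻¹ * ∑ c, adjWeight G b c * if c = a then 0 else nbProb G k s b c v := by
  rw [nbProb, Function.iterate_succ_apply', nbOp_eq_sum, pow_succ, div_mul_eq_div_div,
    div_eq_inv_mul _ ((k : ℝ) - 1), Finset.sum_div]
  congr 1
  refine Finset.sum_congr rfl fun c _ => ?_
  rw [mul_div_assoc]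
  congr 1
  split_ifs
  · simp
  · rfl

lemma nbProb_nonneg (hk1 : 1 ≤ k) (s : ℕ) (a b v : V) : 0 ≤ nbProb G k s a b v := by
  classical
  have hk : (1 : ℝ) ≤ k := by exact_mod_cast hk1
  induction s generalizing a b with
  | zero => rw [nbProb_zero]; split_ifs <;> norm_num
  | succ s ih =>
    rw [nbProb_succ]
    refine mul_nonneg (inv_nonneg.2 (by linarith)) (Finset.sum_nonneg fun c _ =>
      mul_nonneg (adjWeight_nonneg _ _ _) ?_)
    split_ifs
    · exact le_rfl
    · exact ih b c

/-- Going one step further averages over the `k - 1` continuations, and an average preserves a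
uniform upper bound. -/
lemma nbProb_le_of_le (hk : ∀ a, ∑ b, adjWeight G a b = k) (hk2 : 2 ≤ k) {c : ℝ} {s : ℕ} {v : V}
    (h : ∀ a b, G.Adj a b → nbProb G k s a b v ≤ c) {t : ℕ} (hst : s ≤ t) {a b : V}
    (hab : G.Adj a b) : nbProb G k t a b v ≤ c := by
  classical
  have hk1 : (0 : ℝ) < (k : ℝ) - 1 := by
    have : (2 : ℝ) ≤ k := by exact_mod_cast hk2
    linarith
  induction t, hst using Nat.le_induction generalizing a b with
  | base => exact h a b hab
  | succ t _ ih =>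
    rw [nbProb_succ, inv_mul_le_iff₀ hk1]
    calc ∑ x, (adjWeight G b x * if x = a then 0 else nbProb G k t b x v)
        ≤ ∑ x, adjWeight G b x * (if x = a then 0 else c) := by
          refine Finset.sum_le_sum fun x _ => ?_
          by_cases hx : G.Adj b x
          · refine mul_le_mul_of_nonneg_left ?_ (adjWeight_nonneg _ _ _)
            split_ifs
            · exact le_rfl
            · exact ih hx
          · simp [adjWeight, hx]
      _ = (k - 1) * c := by
          rw [← nbOp_eq_sum (fun _ _ => c), nbOp, outSum, ← Finset.sum_mul, hk]
          simp [adjWeight, hab.symm]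
          ring

/-- Constants are multiplied by `k - 1` only along edges, where the reversed edge is really
subtracted; hence the adjacency hypothesis. -/
lemma iterate_nbOp_add_const (hk : ∀ a, ∑ b, adjWeight G a b = k) (f : V → V → ℝ) (c : ℝ) (s : ℕ)
    {a b : V} (hab : G.Adj a b) :
    (nbOp G)^[s] (fun a b => f a b + c) a b = (nbOp G)^[s] f a b + ((k : ℝ) - 1) ^ s * c := by
  induction s generalizing a b with
  | zero => simp
  | succ s ih =>
    rw [Function.iterate_succ_apply', nbOp_congr fun a b hab => ih hab,
      Function.iterate_succ_apply']
    simp only [nbOp, outSum, mul_add, Finset.sum_add_distrib, ← Finset.sum_mul, hk]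
    simp only [adjWeight, hab.symm, if_true]
    ring

lemma sum_outSum_iterate_nbOp (hk : ∀ a, ∑ b, adjWeight G a b = k) (f : V → V → ℝ)
    (hf : ∑ a, outSum G f a = 0) (s : ℕ) : ∑ a, outSum G ((nbOp G)^[s] f) a = 0 := by
  induction s with
  | zero => exact hf
  | succ s ih => rw [Function.iterate_succ_apply', sum_outSum_nbOp hk, ih, mul_zero]

/-- Non-backtracking walks on expanders mix in a logarithmic number of steps. -/
lemma exists_nbProb_le (hk3 : 3 ≤ k) (hσ0 : 0 ≤ σ) (hσ : σ < k) :
    ∃ θ : ℝ, 0 < θ ∧ θ < 1 ∧ ∀ {V : Type*} [Fintype V] {G : SimpleGraph V},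
      (∀ a, ∑ b, adjWeight G a b = k) → SpectralBound G σ →
      ∀ m : ℕ, θ ^ m * k ≤ (1 / (Fintype.card V : ℝ)) ^ 2 → ∀ s, 2 * m ≤ s →
        ∀ a b v : V, G.Adj a b → nbProb G k s a b v ≤ 2 / Fintype.card V := by
  classical
  obtain ⟨θ, hθ0, hθ1, h⟩ := exists_edgeEnergy_contraction hk3 hσ0 hσ
  refine ⟨θ, hθ0, hθ1, fun {V} _ {G} hk hS m hm s hs a b v hab => ?_⟩
  refine nbProb_le_of_le hk (by omega) (fun a b hab => ?_) hs hab
  have hV : (0 : ℝ) < Fintype.card V := by exact_mod_cast Fintype.card_pos_iff.2 ⟨a⟩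
  set n : ℝ := (Fintype.card V : ℝ) with hn
  have hk1 : (0 : ℝ) < (k : ℝ) - 1 := by
    have : (3 : ℝ) ≤ k := by exact_mod_cast hk3
    linarith
  -- The target's indicator minus its equilibrium value `1 / n`. Equilibrium contributes `1 / n` to
  -- the final bound, and the deviation at most another `1 / n`.
  set f : V → V → ℝ := fun _ b => (if b = v then 1 else 0) - 1 / n with hf
  have hf0 : ∑ a, outSum G f a = 0 := by
    have := sum_sum_adj_right hk fun b => (if b = v then (1 : ℝ) else 0) - 1 / n
    refine this.trans ?_
    rw [Finset.sum_sub_distrib]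
    simp [← hn, hV.ne']
  have hfE : edgeEnergy G f ≤ k := by
    refine (sum_sum_adj_right hk fun b => ((if b = v then (1 : ℝ) else 0) - 1 / n) ^ 2).trans_le ?_
    have e : ∀ b, ((if b = v then (1 : ℝ) else 0) - 1 / n) ^ 2 =
        (if b = v then (1 - 2 / n) else 0) + 1 / n ^ 2 := fun b => by
      split_ifs <;> ring
    simp only [e, Finset.sum_add_distrib]
    simp only [Finset.sum_ite_eq', Finset.mem_univ, if_true, Finset.sum_const, Finset.card_univ,
      nsmul_eq_mul, ← hn]
    have e2 : n * (1 / n ^ 2) = 1 / n := by field_simp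
    rw [e2]
    have e3 : 1 - 2 / n + 1 / n ≤ 1 := by
      have : 2 / n = 1 / n + 1 / n := by ring
      have : 0 < 1 / n := by positivity
      linarith
    exact mul_le_of_le_one_right (Nat.cast_nonneg k) e3
  have hiter : ∀ m, edgeEnergy G ((nbOp G)^[2 * m] f) ≤
      θ ^ m * (((k : ℝ) - 1) ^ (2 * m)) ^ 2 * edgeEnergy G f := by
    intro m
    induction m with
    | zero => simp
    | succ m ih =>
      have e : 2 * (m + 1) = 2 * m + 1 + 1 := by ring
      rw [e, Function.iterate_succ_apply', Function.iterate_succ_apply']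
      refine (h hk hS _ (sum_outSum_iterate_nbOp hk f hf0 _)).trans ?_
      refine (mul_le_mul_of_nonneg_left ih (by positivity)).trans_eq ?_
      ring
  have h1 := iterate_nbOp_add_const hk f (1 / n) (2 * m) hab
  have e : (fun a b => f a b + 1 / n) = fun _ b => if b = v then (1 : ℝ) else 0 := by
    funext a b; simp [hf]
  rw [e] at h1
  rw [nbProb]
  have hP : (0 : ℝ) < ((k : ℝ) - 1) ^ (2 * m) := by positivity
  rw [h1, div_le_iff₀ hP]
  -- A single entry is bounded by the whole energy. This is affordable because `m` makes the energy
  -- as small as `1 / n ^ 2` relative to the growth of constants.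
  have h2 : (nbOp G)^[2 * m] f a b ^ 2 ≤ ((((k : ℝ) - 1) ^ (2 * m)) * (1 / n)) ^ 2 := by
    refine (sq_le_edgeEnergy hab _).trans ((hiter m).trans ?_)
    calc θ ^ m * (((k : ℝ) - 1) ^ (2 * m)) ^ 2 * edgeEnergy G f
        ≤ θ ^ m * (((k : ℝ) - 1) ^ (2 * m)) ^ 2 * k :=
          mul_le_mul_of_nonneg_left hfE (by positivity)
      _ = (((k : ℝ) - 1) ^ (2 * m)) ^ 2 * (θ ^ m * k) := by ring
      _ ≤ (((k : ℝ) - 1) ^ (2 * m)) ^ 2 * (1 / n) ^ 2 :=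
          mul_le_mul_of_nonneg_left hm (by positivity)
      _ = _ := by ring
  have h3 := abs_le_of_sq_le_sq h2 (by positivity) |> abs_le.1
  have : 2 / n = 1 / n + 1 / n := by ring
  rw [this]
  linarith [h3.2]

end Mixing

/-! ### Large girth: uniqueness of short walks -/

section Tree

variable {V : Type*} {G : SimpleGraph V} {k : ℕ}

/-- Fewer edges than the girth form a forest. -/
lemma isAcyclic_fromEdgeSet_of_length_lt {l : List (Sym2 V)} (hl : ∀ e ∈ l, e ∈ G.edgeSet)
    (h : (l.length : ℕ∞) < G.egirth) : (SimpleGraph.fromEdgeSet {e | e ∈ l}).IsAcyclic := by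
  classical
  have hle : SimpleGraph.fromEdgeSet {e | e ∈ l} ≤ G := by
    rw [← SimpleGraph.edgeSet_subset_edgeSet, SimpleGraph.edgeSet_fromEdgeSet]
    exact fun e he => hl e he.1
  intro v c hc
  have h1 := SimpleGraph.egirth_le_length (hc.mapLe hle)
  have h2 : c.edges.length ≤ l.length := by
    refine (List.subperm_of_subset hc.edges_nodup fun e he => ?_).length_le
    have := c.edges_subset_edgeSet he
    rw [SimpleGraph.edgeSet_fromEdgeSet] at this
    exact this.1
  rw [SimpleGraph.Walk.length_edges] at h2
  rw [SimpleGraph.Walk.length_map] at h1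
  exact absurd (h1.trans (by exact_mod_cast h2)) (not_le.2 h)

/-- The edges of both walks together are too few to contain a cycle. In the forest they form,
non-backtracking walks are paths, and a path is determined by its ends. -/
lemma nonbacktracking_walk_unique {b v : V} (p q : G.Walk b v) (hp : p.edges.IsChain (· ≠ ·))
    (hq : q.edges.IsChain (· ≠ ·)) (h : ((p.length + q.length : ℕ) : ℕ∞) < G.egirth) : p = q := by
  have hH := isAcyclic_fromEdgeSet_of_length_lt (G := G) (l := p.edges ++ q.edges)
    (fun e he => (List.mem_append.1 he).elim (fun h => p.edges_subset_edgeSet h)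
      fun h => q.edges_subset_edgeSet h) (by simpa using h)
  have hmem : ∀ e ∈ p.edges ++ q.edges,
      e ∈ (SimpleGraph.fromEdgeSet {e | e ∈ p.edges ++ q.edges}).edgeSet := fun e he => by
    rw [SimpleGraph.edgeSet_fromEdgeSet]
    refine ⟨he, ?_⟩
    have : e ∈ G.edgeSet := (List.mem_append.1 he).elim (fun h => p.edges_subset_edgeSet h)
      fun h => q.edges_subset_edgeSet h
    exact G.not_isDiag_of_mem_edgeSet this
  have h1 : ∀ e ∈ p.edges, e ∈ (SimpleGraph.fromEdgeSet {e | e ∈ p.edges ++ q.edges}).edgeSet :=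
    fun e he => hmem e (List.mem_append_left _ he)
  have h2 : ∀ e ∈ q.edges, e ∈ (SimpleGraph.fromEdgeSet {e | e ∈ p.edges ++ q.edges}).edgeSet :=
    fun e he => hmem e (List.mem_append_right _ he)
  have hp' : (p.transfer _ h1).IsPath := by
    rw [hH.isPath_iff_isChain, SimpleGraph.Walk.edges_transfer]; exact hp
  have hq' : (q.transfer _ h2).IsPath := by
    rw [hH.isPath_iff_isChain, SimpleGraph.Walk.edges_transfer]; exact hq
  have := congrArg (fun r : SimpleGraph.Path _ _ _ => r.1.support) 
    ((hH.subsingleton_path _ _).elim ⟨_, hp'⟩ ⟨_, hq'⟩)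
  simp only [SimpleGraph.Walk.support_transfer] at this
  exact SimpleGraph.Walk.ext_support this

variable [Fintype V]

/-- The edge just crossed is kept at the head of the chain so that the induction can prepend a step.
-/
lemma exists_walk_of_nbProb_ne_zero {s : ℕ} {a b v : V} (hab : G.Adj a b)
    (h : nbProb G k s a b v ≠ 0) :
    ∃ p : G.Walk b v, p.length = s ∧ (s(a, b) :: p.edges).IsChain (· ≠ ·) := by
  classical
  induction s generalizing a b with
  | zero =>
    rw [nbProb_zero] at h
    obtain rfl : b = v := by by_contra h'; simp [h'] at h
    exact ⟨.nil, rfl, by simp⟩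
  | succ s ih =>
    rw [nbProb_succ] at h
    obtain ⟨c, -, hc⟩ := Finset.exists_ne_zero_of_sum_ne_zero (right_ne_zero_of_mul h)
    have hbc : G.Adj b c := by
      by_contra h'; simp [adjWeight, h'] at hc
    have hca : c ≠ a := by rintro rfl; simp at hc
    rw [if_neg hca] at hc
    obtain ⟨p, hp, hch⟩ := ih hbc (right_ne_zero_of_mul hc)
    refine ⟨.cons hbc p, by simp [hp], ?_⟩
    rw [SimpleGraph.Walk.edges_cons, List.isChain_cons_cons]
    refine ⟨fun h => ?_, hch⟩
    rw [Sym2.eq_swap, Sym2.eq_iff] at h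
    rcases h with ⟨-, h⟩ | ⟨h, -⟩
    · exact hca h.symm
    · exact hbc.ne h

/-- By uniqueness of short walks at most one neighbour of `b` can lead to `v` in the remaining
steps, so each step costs a factor `k - 1`. -/
lemma nbProb_le_pow (hk2 : 2 ≤ k) {s : ℕ} (hs : ((2 * s : ℕ) : ℕ∞) < G.egirth) {a b v : V}
    (hab : G.Adj a b) : nbProb G k s a b v ≤ (((k : ℝ) - 1)⁻¹) ^ s := by
  classical
  have hk1 : (0 : ℝ) < (k : ℝ) - 1 := by
    have : (2 : ℝ) ≤ k := by exact_mod_cast hk2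
    linarith
  induction s generalizing a b with
  | zero => rw [nbProb_zero]; split_ifs <;> norm_num
  | succ s ih =>
    rw [nbProb_succ, pow_succ']
    refine mul_le_mul_of_nonneg_left ?_ (by positivity)
    have hpos : 0 ≤ ((k : ℝ) - 1)⁻¹ ^ s := by positivity
    have hs' : ((2 * s : ℕ) : ℕ∞) < G.egirth :=
      lt_of_le_of_lt (by exact_mod_cast (by omega : 2 * s ≤ 2 * (s + 1))) hs
    have key : ∀ c, adjWeight G b c * (if c = a then 0 else nbProb G k s b c v) ≠ 0 →
        G.Adj b c ∧ c ≠ a ∧ nbProb G k s b c v ≠ 0 := fun c hc => by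
      have hbc : G.Adj b c := by
        by_contra h'; simp [adjWeight, h'] at hc
      have hca : c ≠ a := by rintro rfl; simp at hc
      rw [if_neg hca] at hc
      exact ⟨hbc, hca, right_ne_zero_of_mul hc⟩
    by_cases hz : ∃ c, adjWeight G b c * (if c = a then 0 else nbProb G k s b c v) ≠ 0
    · obtain ⟨c, hc⟩ := hz
      obtain ⟨hbc, hca, hc0⟩ := key c hc
      obtain ⟨p, hp, hpc⟩ := exists_walk_of_nbProb_ne_zero hbc hc0
      rw [Finset.sum_eq_single c]
      · rw [if_neg hca]
        simp only [adjWeight, hbc, if_true, one_mul]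
        exact ih hs' hbc
      · intro c' _ hne
        by_contra hc'
        obtain ⟨hbc', -, hc0'⟩ := key c' hc'
        obtain ⟨q, hq, hqc⟩ := exists_walk_of_nbProb_ne_zero hbc' hc0'
        have := nonbacktracking_walk_unique (.cons hbc p) (.cons hbc' q)
          (by simpa using hpc) (by simpa using hqc)
          (by simpa [hp, hq, two_mul] using hs)
        have h2 := congrArg (fun r : G.Walk b v => r.snd) this
        simp at h2
        exact hne h2.symm
      · simp
    · push Not at hz
      simp only [hz, Finset.sum_const_zero, hpos]

/-- A return would be a closed non-backtracking walk shorter than the girth, and uniqueness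
identifies it with the trivial walk. -/
lemma nbProb_eq_zero_of_lt_egirth {s : ℕ} (hs : ((s + 1 : ℕ) : ℕ∞) < G.egirth) {a b : V}
    (hab : G.Adj a b) : nbProb G k s a b a = 0 := by
  by_contra h
  obtain ⟨p, hp, hpc⟩ := exists_walk_of_nbProb_ne_zero hab h
  have := nonbacktracking_walk_unique (.cons hab p) .nil (by simpa using hpc) (by simp)
    (by simpa [hp] using hs)
  simp at this

end Tree

/-! ### Conditional bounds for one walk -/

section SingleWalk

variable {V Ω : Type*} [MeasurableSpace V] [MeasurableSpace Ω]
  {G : SimpleGraph V} {μ : Measure Ω} {W : ℕ → Ω → V} {k : ℕ}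

/-- The trajectories that agree with `p` up to time `t`. -/
def pathCylinder {V : Type*} (t : ℕ) (p : ℕ → V) : Set (ℕ → V) := {w | ∀ s ≤ t, w s = p s}

/-- The event that the trajectory of the walk `W` lies in `B`. -/
def walkEvent (W : ℕ → Ω → V) (B : Set (ℕ → V)) : Set Ω := {ω | (fun t => W t ω) ∈ B}

/-- Upper bounds, conditional on the past of a walk: `q` for the probability of being at a given
vertex at least `M` steps later, and `δ` for the probability of a return at a given later time. -/
structure WalkBounds (μ : Measure Ω) (W : ℕ → Ω → V) (M : ℕ) (q δ : ℝ) : Prop where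
  measurable : ∀ t, Measurable (W t)
  mixing : ∀ (t : ℕ) (p : ℕ → V) (s : ℕ) (v : V), M ≤ s →
    μ.real (walkEvent W (pathCylinder t p ∩ {w | w (t + s) = v})) ≤
      q * μ.real (walkEvent W (pathCylinder t p))
  return_le : ∀ (t : ℕ) (p : ℕ → V) (s : ℕ), 1 ≤ s →
    μ.real (walkEvent W (pathCylinder t p ∩ {w | w (t + s) = w t})) ≤
      δ * μ.real (walkEvent W (pathCylinder t p))

lemma measurableSet_pathCylinder [DiscreteMeasurableSpace V] (t : ℕ) (p : ℕ → V) :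
    MeasurableSet (pathCylinder t p) := by
  have : pathCylinder t p = ⋂ s ∈ Set.Iic t, (fun w : ℕ → V => w s) ⁻¹' {p s} := by
    ext w; simp [pathCylinder]
  rw [this]
  exact MeasurableSet.biInter (Set.to_countable _) fun s _ =>
    measurable_pi_apply s (MeasurableSet.of_discrete)

lemma measurableSet_walkEvent (hW : ∀ t, Measurable (W t)) {B : Set (ℕ → V)}
    (hB : MeasurableSet B) : MeasurableSet (walkEvent W B) :=
  (measurable_pi_lambda (fun ω t => W t ω) hW) hB

lemma mem_pathCylinder_update_succ {V : Type*} (t : ℕ) (p : ℕ → V) (c : V) (w : ℕ → V) :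
    w ∈ pathCylinder (t + 1) (Function.update p (t + 1) c) ↔
      w ∈ pathCylinder t p ∧ w (t + 1) = c := by
  constructor
  · intro h
    refine ⟨fun s hs => ?_, ?_⟩
    · have := h s (by omega)
      rwa [Function.update_of_ne (by omega)] at this
    · simpa using h (t + 1) le_rfl
  · rintro ⟨h1, h2⟩ s hs
    rcases Nat.lt_or_ge s (t + 1) with h | h
    · rw [Function.update_of_ne (by omega)]; exact h1 s (by omega)
    · obtain rfl : s = t + 1 := by omega
      simpa using h2

lemma uniformMass_toReal_le {V : Type*} (S : Set V) {m : ℝ} (hm : 0 < m) (hS : m ≤ S.ncard) (v : V) :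
    (uniformMass S v).toReal ≤ m⁻¹ * S.indicator (fun _ => 1) v := by
  unfold uniformMass
  by_cases hv : v ∈ S
  · simp only [Set.indicator_of_mem hv, mul_one, ENNReal.toReal_inv, ENNReal.toReal_natCast]
    exact inv_anti₀ hm hS
  · simp [Set.indicator_of_notMem hv]

lemma ncard_neighborSet {V : Type*} [Fintype V] {G : SimpleGraph V}
    (hk : ∀ a, ∑ b, adjWeight G a b = k) (a : V) :
    (G.neighborSet a).ncard = k := by
  classical
  rw [← card_filter_adj hk a, ← Set.ncard_coe_finset]
  congr 1
  ext b; simp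

lemma IsNonBacktrackingWalk.real_eq_zero_of_not_adj (hW : IsNonBacktrackingWalk G μ W)
    (t : ℕ) (p : ℕ → V) (h : ¬ G.Adj (p t) (p (t + 1))) :
    μ.real (walkEvent W (pathCylinder (t + 1) p)) = 0 := by
  rw [Measure.real]
  cases t with
  | zero =>
    have e : walkEvent W (pathCylinder (0 + 1) p) = {ω | W 0 ω = p 0 ∧ W 1 ω = p 1} := by
      ext ω
      refine ⟨fun h => ⟨h 0 (by omega), h 1 (by omega)⟩, fun h s hs => ?_⟩
      interval_cases s
      · exact h.1
      · exact h.2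
    rw [e, hW.first_step, uniformMass, Set.indicator_of_notMem (by exact h)]
    simp
  | succ t =>
    have e : walkEvent W (pathCylinder (t + 1 + 1) p) =
        {ω | (∀ s ≤ t + 1, W s ω = p s) ∧ W (t + 2) ω = p (t + 2)} := by
      ext ω
      refine ⟨fun h => ⟨fun s hs => h s (by omega), h _ le_rfl⟩, fun h s hs => ?_⟩
      rcases Nat.lt_or_ge s (t + 2) with h' | h'
      · exact h.1 s (by omega)
      · obtain rfl : s = t + 2 := by omega
        exact h.2
    rw [e, hW.next_step, uniformMass, Set.indicator_of_notMem (fun h' => h h'.1)]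
    simp

variable [Fintype V]

lemma IsNonBacktrackingWalk.real_step_le (hW : IsNonBacktrackingWalk G μ W)
    (hk : ∀ a, ∑ b, adjWeight G a b = k) (hk2 : 2 ≤ k) (t : ℕ) (p : ℕ → V) (v : V) :
    μ.real (walkEvent W (pathCylinder (t + 2) (Function.update p (t + 2) v))) ≤
      μ.real (walkEvent W (pathCylinder (t + 1) p)) *
        (((k : ℝ) - 1)⁻¹ * (G.neighborSet (p (t + 1)) \ {p t}).indicator (fun _ => 1) v) := by
  have hk1 : (0 : ℝ) < (k : ℝ) - 1 := by
    have : (2 : ℝ) ≤ k := by exact_mod_cast hk2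
    linarith
  have h := congrArg ENNReal.toReal (hW.next_step t p v)
  rw [ENNReal.toReal_mul] at h
  have e : walkEvent W (pathCylinder (t + 2) (Function.update p (t + 2) v)) =
      {ω | (∀ s ≤ t + 1, W s ω = p s) ∧ W (t + 2) ω = v} := by
    ext ω
    exact mem_pathCylinder_update_succ (t + 1) p v fun t => W t ω
  rw [Measure.real, e, h]
  refine mul_le_mul_of_nonneg_left (uniformMass_toReal_le _ hk1 ?_ v) ENNReal.toReal_nonneg
  have h1 := Set.pred_ncard_le_ncard_sdiff_singleton (G.neighborSet (p (t + 1))) (p t)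
  rw [ncard_neighborSet hk] at h1
  have : k ≤ (G.neighborSet (p (t + 1)) \ {p t}).ncard + 1 := by omega
  have : (k : ℝ) ≤ (G.neighborSet (p (t + 1)) \ {p t}).ncard + 1 := by exact_mod_cast this
  linarith

lemma real_walkEvent_le_sum [IsFiniteMeasure μ] (t : ℕ) (p : ℕ → V) (B : Set (ℕ → V)) :
    μ.real (walkEvent W (pathCylinder t p ∩ B)) ≤ ∑ c,
      μ.real (walkEvent W (pathCylinder (t + 1) (Function.update p (t + 1) c) ∩ B)) := by
  refine (measureReal_mono ?_ (measure_ne_top _ _)).trans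
    (measureReal_biUnion_finset_le Finset.univ _)
  intro ω hω
  refine Set.mem_biUnion (x := W (t + 1) ω) (by simp) ?_
  exact ⟨(mem_pathCylinder_update_succ _ _ _ _).2 ⟨hω.1, rfl⟩, hω.2⟩

lemma real_walkEvent_eq_sum [IsFiniteMeasure μ] [DiscreteMeasurableSpace V]
    (hW : ∀ t, Measurable (W t)) (t : ℕ) (p : ℕ → V) :
    μ.real (walkEvent W (pathCylinder t p)) = ∑ c,
      μ.real (walkEvent W (pathCylinder (t + 1) (Function.update p (t + 1) c))) := by
  rw [← measureReal_biUnion_finset]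
  · congr 1
    ext ω
    simp only [Set.mem_iUnion, Finset.mem_univ, exists_prop, true_and]
    exact ⟨fun h => ⟨W (t + 1) ω, (mem_pathCylinder_update_succ _ _ _ _).2 ⟨h, rfl⟩⟩,
      fun ⟨c, h⟩ => ((mem_pathCylinder_update_succ _ _ _ _).1 h).1⟩
  · intro c _ c' _ hcc'
    refine Set.disjoint_left.2 fun ω h h' => hcc' ?_
    exact ((mem_pathCylinder_update_succ _ _ _ _).1 h).2.symm.trans
      ((mem_pathCylinder_update_succ _ _ _ _).1 h').2
  · exact fun c _ => measurableSet_walkEvent hW (measurableSet_pathCylinder _ _)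

/-- The Markov property of the walk on directed edges: the state at time `t + 1` is the edge from `p
t` to `p (t + 1)`, and one conditions on the next vertex. -/
lemma IsNonBacktrackingWalk.real_future_le [IsFiniteMeasure μ]
    (hW : IsNonBacktrackingWalk G μ W) (hk : ∀ a, ∑ b, adjWeight G a b = k) (hk2 : 2 ≤ k)
    (s t : ℕ) (p : ℕ → V) (v : V) :
    μ.real (walkEvent W (pathCylinder (t + 1) p ∩ {w | w (t + 1 + s) = v})) ≤
      μ.real (walkEvent W (pathCylinder (t + 1) p)) * nbProb G k s (p t) (p (t + 1)) v := by
  classical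
  induction s generalizing t p with
  | zero =>
    rw [nbProb_zero]
    split_ifs with h
    · rw [mul_one]
      exact measureReal_mono fun ω hω => hω.1
    · have : walkEvent W (pathCylinder (t + 1) p ∩ {w | w (t + 1 + 0) = v}) = ∅ := by
        refine Set.eq_empty_of_forall_notMem fun ω hω => h ?_
        exact (hω.1 (t + 1) le_rfl).symm.trans hω.2
      simp [this]
  | succ s ih =>
    refine (real_walkEvent_le_sum _ _ _).trans ?_
    rw [nbProb_succ, Finset.mul_sum, Finset.mul_sum]
    refine Finset.sum_le_sum fun c _ => ?_
    have h1 := ih (t + 1) (Function.update p (t + 2) c)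
    have e : t + 1 + (s + 1) = t + 1 + 1 + s := by ring
    rw [e]
    refine h1.trans ?_
    rw [Function.update_of_ne (by omega), Function.update_self]
    refine (mul_le_mul_of_nonneg_right (hW.real_step_le hk hk2 t p c)
      (nbProb_nonneg (by omega) _ _ _ _)).trans_eq ?_
    by_cases hc : c = p t
    · simp [hc]
    · by_cases hb : G.Adj (p (t + 1)) c
      · simp [hc, hb, adjWeight]; ring
      · simp [hc, hb, adjWeight]

/-- Summing over the vertex after time `t` supplies the directed edge, so that `t = 0`, when no edge
has been crossed yet, needs no separate treatment. This costs the extra step in `s + 1`. -/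
lemma IsNonBacktrackingWalk.real_le_of_nbProb_le [IsFiniteMeasure μ] [DiscreteMeasurableSpace V]
    (hW : IsNonBacktrackingWalk G μ W) (hk : ∀ a, ∑ b, adjWeight G a b = k) (hk2 : 2 ≤ k)
    (s t : ℕ) (p : ℕ → V) (v : V) {q : ℝ}
    (hq : ∀ c, G.Adj (p t) c → nbProb G k s (p t) c v ≤ q) :
    μ.real (walkEvent W (pathCylinder t p ∩ {w | w (t + (s + 1)) = v})) ≤
      q * μ.real (walkEvent W (pathCylinder t p)) := by
  refine (real_walkEvent_le_sum _ _ _).trans ?_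
  rw [real_walkEvent_eq_sum hW.measurable, Finset.mul_sum]
  refine Finset.sum_le_sum fun c _ => ?_
  have e : t + (s + 1) = t + 1 + s := by ring
  rw [e]
  refine (hW.real_future_le hk hk2 s t _ v).trans ?_
  by_cases hc : G.Adj (p t) c
  · rw [mul_comm]
    refine mul_le_mul_of_nonneg_right ?_ measureReal_nonneg
    rw [Function.update_of_ne (by omega), Function.update_self]
    exact hq c hc
  · rw [hW.real_eq_zero_of_not_adj t (Function.update p (t + 1) c)
      (by rwa [Function.update_of_ne (by omega), Function.update_self])]
    simp

/-- A return after at most `ρ` steps is excluded by the girth. For later ones, the bound valid `ρ`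
steps after the first edge persists by averaging. -/
lemma IsNonBacktrackingWalk.walkBounds [IsFiniteMeasure μ] [DiscreteMeasurableSpace V]
    (hW : IsNonBacktrackingWalk G μ W) (hk : ∀ a, ∑ b, adjWeight G a b = k) (hk2 : 2 ≤ k)
    {m ρ : ℕ} {q : ℝ} (hq : ∀ s, m ≤ s → ∀ a b v, G.Adj a b → nbProb G k s a b v ≤ q)
    (hρ : ((2 * ρ + 1 : ℕ) : ℕ∞) ≤ G.egirth) :
    WalkBounds μ W (m + 1) q ((((k : ℝ) - 1)⁻¹) ^ ρ) where
  measurable := hW.measurable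
  mixing t p s v hs := by
    obtain ⟨s, rfl⟩ : ∃ r, s = r + 1 := ⟨s - 1, by omega⟩
    exact hW.real_le_of_nbProb_le hk hk2 s t p v fun c hc => hq s (by omega) _ _ _ hc
  return_le t p s hs := by
    obtain ⟨s, rfl⟩ : ∃ r, s = r + 1 := ⟨s - 1, by omega⟩
    have e : walkEvent W (pathCylinder t p ∩ {w | w (t + (s + 1)) = w t}) =
        walkEvent W (pathCylinder t p ∩ {w | w (t + (s + 1)) = p t}) := by
      ext ω
      refine and_congr_right fun h => ?_
      have := h t le_rfl
      simp only [Set.mem_ofPred_eq] at this ⊢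
      rw [this]
    rw [e]
    refine hW.real_le_of_nbProb_le hk hk2 s t p _ fun c hc => ?_
    have hk1 : (0 : ℝ) < (k : ℝ) - 1 := by
      have : (2 : ℝ) ≤ k := by exact_mod_cast hk2
      linarith
    rcases Nat.lt_or_ge s ρ with h | h
    · rw [nbProb_eq_zero_of_lt_egirth (lt_of_lt_of_le (by exact_mod_cast (by omega)) hρ) hc]
      positivity
    · exact nbProb_le_of_le hk hk2 (fun a b hab => nbProb_le_pow hk2
        (lt_of_lt_of_le (by exact_mod_cast (by omega)) hρ) hab) h hc

end SingleWalk

/-! ### Two independent walks, revealed up to different times -/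

section TwoWalks

variable {V Ω α : Type*}

/-- `f` depends on the first trajectory up to time `t` and on the second one up to time `T`. -/
def DependsUpTo (t T : ℕ) (f : (ℕ → V) → (ℕ → V) → α) : Prop :=
  ∀ w₁ w₁' w₂ w₂', (∀ s ≤ t, w₁ s = w₁' s) → (∀ s ≤ T, w₂ s = w₂' s) → f w₁ w₂ = f w₁' w₂'

lemma DependsUpTo.mono {t t' T T' : ℕ} {f : (ℕ → V) → (ℕ → V) → α} (h : DependsUpTo t T f)
    (ht : t ≤ t') (hT : T ≤ T') : DependsUpTo t' T' f :=
  fun _ _ _ _ h₁ h₂ => h _ _ _ _ (fun s hs => h₁ s (hs.trans ht)) fun s hs => h₂ s (hs.trans hT)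

lemma DependsUpTo.and {t T : ℕ} {A B : (ℕ → V) → (ℕ → V) → Prop} (hA : DependsUpTo t T A)
    (hB : DependsUpTo t T B) : DependsUpTo t T fun w₁ w₂ => A w₁ w₂ ∧ B w₁ w₂ :=
  fun _ _ _ _ h₁ h₂ => by
    change (_ ∧ _) = (_ ∧ _)
    rw [hA _ _ _ _ h₁ h₂, hB _ _ _ _ h₁ h₂]

lemma DependsUpTo.swap {t T : ℕ} {f : (ℕ → V) → (ℕ → V) → α} (h : DependsUpTo t T f) :
    DependsUpTo T t fun w₁ w₂ => f w₂ w₁ :=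
  fun _ _ _ _ h₁ h₂ => h _ _ _ _ h₂ h₁

lemma DependsUpTo.comp {β : Type*} {t T : ℕ} {f : (ℕ → V) → (ℕ → V) → α} (h : DependsUpTo t T f)
    (g : α → β) : DependsUpTo t T fun w₁ w₂ => g (f w₁ w₂) :=
  fun _ _ _ _ h₁ h₂ => congrArg g (h _ _ _ _ h₁ h₂)

lemma dependsUpTo_fst {s t : ℕ} (hs : s ≤ t) (T : ℕ) :
    DependsUpTo t T fun (w₁ : ℕ → V) (_ : ℕ → V) => w₁ s :=
  fun _ _ _ _ h₁ _ => h₁ s hs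

variable [MeasurableSpace Ω]

/-- The event that the two trajectories satisfy `A`. -/
def pairEvent (W₁ W₂ : ℕ → Ω → V) (A : (ℕ → V) → (ℕ → V) → Prop) : Set Ω :=
  {ω | A (fun t => W₁ t ω) fun t => W₂ t ω}

/-- The probability that the two trajectories satisfy `A`. -/
noncomputable def pairProb (μ : Measure Ω) (W₁ W₂ : ℕ → Ω → V)
    (A : (ℕ → V) → (ℕ → V) → Prop) : ℝ :=
  μ.real (pairEvent W₁ W₂ A)

variable {μ : Measure Ω} {W₁ W₂ : ℕ → Ω → V} {A B : (ℕ → V) → (ℕ → V) → Prop} {M : ℕ} {q δ : ℝ}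

lemma pairProb_nonneg : 0 ≤ pairProb μ W₁ W₂ A := measureReal_nonneg

lemma pairProb_mono [IsFiniteMeasure μ] (h : ∀ w₁ w₂, A w₁ w₂ → B w₁ w₂) :
    pairProb μ W₁ W₂ A ≤ pairProb μ W₁ W₂ B :=
  measureReal_mono (fun _ hω => h _ _ hω) (measure_ne_top _ _)

lemma pairProb_le_one [IsProbabilityMeasure μ] : pairProb μ W₁ W₂ A ≤ 1 := measureReal_le_one

lemma pairProb_swap : pairProb μ W₂ W₁ (fun w₁ w₂ => A w₂ w₁) = pairProb μ W₁ W₂ A := rfl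

lemma pairProb_le_sum [IsFiniteMeasure μ] {ι : Type*} (F : Finset ι)
    {B : ι → (ℕ → V) → (ℕ → V) → Prop} (h : ∀ w₁ w₂, A w₁ w₂ → ∃ i ∈ F, B i w₁ w₂) :
    pairProb μ W₁ W₂ A ≤ ∑ i ∈ F, pairProb μ W₁ W₂ (B i) := by
  refine (measureReal_mono (fun ω hω => ?_) ?_).trans (measureReal_biUnion_finset_le F _)
  · obtain ⟨i, hi, h⟩ := h _ _ hω
    exact Set.mem_biUnion (x := i) hi h
  · exact measure_ne_top _ _

lemma pairProb_le_add [IsFiniteMeasure μ] {C : (ℕ → V) → (ℕ → V) → Prop}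
    (h : ∀ w₁ w₂, A w₁ w₂ → B w₁ w₂ ∨ C w₁ w₂) :
    pairProb μ W₁ W₂ A ≤ pairProb μ W₁ W₂ B + pairProb μ W₁ W₂ C :=
  (measureReal_mono (s₂ := pairEvent W₁ W₂ B ∪ pairEvent W₁ W₂ C) (fun _ hω => h _ _ hω)
    (measure_ne_top _ _)).trans (measureReal_union_le _ _)

open Classical in
-- The left side is the expected number of events that occur. It allows a union over a random set at
-- the price of its size rather than of all candidates.
lemma sum_measureReal_le [IsFiniteMeasure μ] {ι : Type*} (F : Finset ι) {B : ι → Set Ω} {A : Set Ω}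
    (hB : ∀ i ∈ F, MeasurableSet (B i)) (hA : MeasurableSet A) {β : ℝ}
    (h : ∀ ω, (∃ i ∈ F, ω ∈ B i) → ω ∈ A)
    (hc : ∀ ω ∈ A, ((F.filter fun i => ω ∈ B i).card : ℝ) ≤ β) :
    ∑ i ∈ F, μ.real (B i) ≤ β * μ.real A := by
  have hint : ∀ i ∈ F, Integrable ((B i).indicator fun _ => (1 : ℝ)) μ := fun i hi =>
    (integrable_const 1).indicator (hB i hi)
  have h1 : ∑ i ∈ F, μ.real (B i) = ∫ ω, ∑ i ∈ F, (B i).indicator (fun _ => (1 : ℝ)) ω ∂μ := by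
    rw [integral_finsetSum _ hint]
    refine Finset.sum_congr rfl fun i hi => ?_
    rw [integral_indicator (hB i hi)]
    simp
  have h2 : β * μ.real A = ∫ ω, A.indicator (fun _ => β) ω ∂μ := by
    rw [integral_indicator hA]
    simp [mul_comm]
  rw [h1, h2]
  refine integral_mono (integrable_finsetSum _ hint) ((integrable_const β).indicator hA) ?_
  intro ω
  have e : ∑ i ∈ F, (B i).indicator (fun _ => (1 : ℝ)) ω = (F.filter fun i => ω ∈ B i).card := by
    simp [Set.indicator_apply]
  simp only [e]
  by_cases hω : ω ∈ A
  · rw [Set.indicator_of_mem hω]; exact hc ω hω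
  · rw [Set.indicator_of_notMem hω, Finset.filter_eq_empty_iff.2]
    · simp
    · exact fun i hi hi' => hω (h ω ⟨i, hi, hi'⟩)

open Classical in
/-- Markov's inequality for the number of events that occur. -/
lemma mul_measureReal_card_ge_le [IsFiniteMeasure μ] {ι : Type*} (F : Finset ι) {B : ι → Set Ω}
    (hB : ∀ i ∈ F, MeasurableSet (B i)) (a : ℝ) :
    a * μ.real {ω | a ≤ ((F.filter fun i => ω ∈ B i).card : ℝ)} ≤ ∑ i ∈ F, μ.real (B i) := by
  have hint : ∀ i ∈ F, Integrable ((B i).indicator fun _ => (1 : ℝ)) μ := fun i hi =>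
    (integrable_const 1).indicator (hB i hi)
  have h1 : ∑ i ∈ F, μ.real (B i) = ∫ ω, ∑ i ∈ F, (B i).indicator (fun _ => (1 : ℝ)) ω ∂μ := by
    rw [integral_finsetSum _ hint]
    refine Finset.sum_congr rfl fun i hi => ?_
    rw [integral_indicator (hB i hi)]
    simp
  have e : ∀ ω, ∑ i ∈ F, (B i).indicator (fun _ => (1 : ℝ)) ω = (F.filter fun i => ω ∈ B i).card :=
    fun ω => by simp [Set.indicator_apply]
  rw [h1]
  simp only [← e]
  exact mul_meas_ge_le_integral_of_nonneg (Eventually.of_forall fun ω =>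
    Finset.sum_nonneg fun i _ => Set.indicator_nonneg (fun _ _ => zero_le_one) _)
    (integrable_finsetSum _ hint) a

variable [MeasurableSpace V] [DiscreteMeasurableSpace V] [Fintype V]

/-- The extension of a finite trajectory to all times. -/
def extendPath {t : ℕ} (x : Fin (t + 1) → V) (s : ℕ) : V := x (Fin.ofNat (t + 1) s)

lemma mem_pathCylinder_extendPath {t : ℕ} (x : Fin (t + 1) → V) (w : ℕ → V) :
    w ∈ pathCylinder t (extendPath x) ↔ (fun i : Fin (t + 1) => w i) = x := by
  constructor
  · intro h
    funext i
    rw [h i (Nat.lt_succ_iff.1 i.2), extendPath]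
    congr 1
    ext
    simp
  · rintro rfl s hs
    simp [extendPath, Nat.mod_eq_of_lt (Nat.lt_succ_iff.2 hs)]

open Classical in
lemma pairEvent_eq_iUnion {t T : ℕ} (hA : DependsUpTo t T A) (B : Set (ℕ → V)) :
    pairEvent W₁ W₂ A ∩ walkEvent W₁ B = ⋃ x ∈ (Finset.univ.filter
      fun x : (Fin (t + 1) → V) × (Fin (T + 1) → V) => A (extendPath x.1) (extendPath x.2)),
      walkEvent W₁ (pathCylinder t (extendPath x.1) ∩ B) ∩
        walkEvent W₂ (pathCylinder T (extendPath x.2)) := by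
  ext ω
  simp only [Set.mem_iUnion, Finset.mem_filter, Finset.mem_univ, true_and, exists_prop]
  constructor
  · rintro ⟨h, hB⟩
    have h₁ := (mem_pathCylinder_extendPath (t := t) _ fun s => W₁ s ω).2 rfl
    have h₂ := (mem_pathCylinder_extendPath (t := T) _ fun s => W₂ s ω).2 rfl
    refine ⟨(fun i => W₁ i ω, fun i => W₂ i ω), ?_, ⟨h₁, hB⟩, h₂⟩
    exact (hA _ _ _ _ h₁ h₂).mp h
  · rintro ⟨x, hx, ⟨h₁, hB⟩, h₂⟩
    exact ⟨(hA _ _ _ _ h₁ h₂).mpr hx, hB⟩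

lemma measurableSet_cylinder_inter (hW₁ : ∀ t, Measurable (W₁ t)) (hW₂ : ∀ t, Measurable (W₂ t))
    {B : Set (ℕ → V)} (hB : MeasurableSet B) (t T : ℕ) (p p' : ℕ → V) :
    MeasurableSet (walkEvent W₁ (pathCylinder t p ∩ B) ∩ walkEvent W₂ (pathCylinder T p')) :=
  (measurableSet_walkEvent hW₁ ((measurableSet_pathCylinder _ _).inter hB)).inter
    (measurableSet_walkEvent hW₂ (measurableSet_pathCylinder _ _))

lemma measurableSet_pairEvent (hW₁ : ∀ t, Measurable (W₁ t)) (hW₂ : ∀ t, Measurable (W₂ t))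
    {t T : ℕ} (hA : DependsUpTo t T A) : MeasurableSet (pairEvent W₁ W₂ A) := by
  have h := pairEvent_eq_iUnion (W₁ := W₁) (W₂ := W₂) hA Set.univ
  have e : pairEvent W₁ W₂ A ∩ walkEvent W₁ Set.univ = pairEvent W₁ W₂ A := by
    ext ω; simp [walkEvent]
  rw [e] at h
  rw [h]
  exact Finset.measurableSet_biUnion _ fun x _ =>
    measurableSet_cylinder_inter hW₁ hW₂ MeasurableSet.univ _ _ _ _

lemma real_pairEvent_inter_eq_sum [IsFiniteMeasure μ] (hW₁ : ∀ t, Measurable (W₁ t))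
    (hW₂ : ∀ t, Measurable (W₂ t))
    (hind : IndepFun (fun ω t => W₁ t ω) (fun ω t => W₂ t ω) μ) {t T : ℕ}
    {B : Set (ℕ → V)} (hB : MeasurableSet B) (F : Finset ((Fin (t + 1) → V) × (Fin (T + 1) → V))) :
    μ.real (⋃ x ∈ F, walkEvent W₁ (pathCylinder t (extendPath x.1) ∩ B) ∩
        walkEvent W₂ (pathCylinder T (extendPath x.2))) =
      ∑ x ∈ F, μ.real (walkEvent W₁ (pathCylinder t (extendPath x.1) ∩ B)) *
        μ.real (walkEvent W₂ (pathCylinder T (extendPath x.2))) := by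
  rw [measureReal_biUnion_finset]
  · refine Finset.sum_congr rfl fun x _ => ?_
    rw [Measure.real, Measure.real, Measure.real, ← ENNReal.toReal_mul]
    congr 1
    exact hind.measure_inter_preimage_eq_mul _ _
      ((measurableSet_pathCylinder _ _).inter hB) (measurableSet_pathCylinder _ _)
  · intro x _ y _ hxy
    refine Set.disjoint_left.2 fun ω h h' => hxy (Prod.ext ?_ ?_)
    · exact ((mem_pathCylinder_extendPath _ _).1 h.1.1).symm.trans
        ((mem_pathCylinder_extendPath _ _).1 h'.1.1)
    · exact ((mem_pathCylinder_extendPath _ _).1 h.2).symm.trans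
        ((mem_pathCylinder_extendPath _ _).1 h'.2)
  · exact fun x _ => measurableSet_cylinder_inter hW₁ hW₂ hB _ _ _ _

/-- The event `A` is a disjoint union of products of cylinders, and on each product independence
reduces the claim to the first walk alone. The time `T` is unrestricted: the second walk may be
revealed further than the first one. -/
lemma pairProb_and_le [IsFiniteMeasure μ] (hW₁ : ∀ t, Measurable (W₁ t))
    (hW₂ : ∀ t, Measurable (W₂ t))
    (hind : IndepFun (fun ω t => W₁ t ω) (fun ω t => W₂ t ω) μ) {t T : ℕ}
    (hA : DependsUpTo t T A) {B : Set (ℕ → V)} (hB : MeasurableSet B)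
    (h : ∀ p, μ.real (walkEvent W₁ (pathCylinder t p ∩ B)) ≤
      q * μ.real (walkEvent W₁ (pathCylinder t p))) :
    pairProb μ W₁ W₂ (fun w₁ w₂ => A w₁ w₂ ∧ w₁ ∈ B) ≤ q * pairProb μ W₁ W₂ A := by
  classical
  have e1 : pairProb μ W₁ W₂ (fun w₁ w₂ => A w₁ w₂ ∧ w₁ ∈ B) =
      μ.real (pairEvent W₁ W₂ A ∩ walkEvent W₁ B) := rfl
  have e2 : pairProb μ W₁ W₂ A = μ.real (pairEvent W₁ W₂ A ∩ walkEvent W₁ Set.univ) := by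
    have : pairEvent W₁ W₂ A ∩ walkEvent W₁ Set.univ = pairEvent W₁ W₂ A := by
      ext ω; simp [walkEvent]
    rw [this]; rfl
  rw [e1, e2, pairEvent_eq_iUnion hA, pairEvent_eq_iUnion hA,
    real_pairEvent_inter_eq_sum hW₁ hW₂ hind hB,
    real_pairEvent_inter_eq_sum hW₁ hW₂ hind MeasurableSet.univ, Finset.mul_sum]
  refine Finset.sum_le_sum fun x _ => ?_
  rw [Set.inter_univ, ← mul_assoc]
  exact mul_le_mul_of_nonneg_right (h _) measureReal_nonneg

/-- Two independent walks with the same conditional bounds. -/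
structure WalkPair (μ : Measure Ω) (W₁ W₂ : ℕ → Ω → V) (M : ℕ) (q δ : ℝ) : Prop where
  fst : WalkBounds μ W₁ M q δ
  snd : WalkBounds μ W₂ M q δ
  indep : IndepFun (fun ω t => W₁ t ω) (fun ω t => W₂ t ω) μ

lemma WalkPair.swap (h : WalkPair μ W₁ W₂ M q δ) : WalkPair μ W₂ W₁ M q δ :=
  ⟨h.snd, h.fst, h.indep.symm⟩

namespace WalkPair

lemma measurableSet (h : WalkPair μ W₁ W₂ M q δ) {t T : ℕ} (hA : DependsUpTo t T A) :
    MeasurableSet (pairEvent W₁ W₂ A) :=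
  measurableSet_pairEvent h.fst.measurable h.snd.measurable hA

variable [IsFiniteMeasure μ]

lemma mixing_fst (h : WalkPair μ W₁ W₂ M q δ) {t T t' : ℕ} (hA : DependsUpTo t T A)
    (ht : t + M ≤ t') (v : V) :
    pairProb μ W₁ W₂ (fun w₁ w₂ => A w₁ w₂ ∧ w₁ t' = v) ≤ q * pairProb μ W₁ W₂ A := by
  obtain ⟨s, rfl⟩ : ∃ s, t' = t + s := ⟨t' - t, by omega⟩
  exact pairProb_and_le h.fst.measurable h.snd.measurable h.indep hA
    (B := {w | w (t + s) = v})
    (measurableSet_eq_fun (measurable_pi_apply _) measurable_const)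
    fun p => h.fst.mixing t p s v (by omega)

lemma return_fst (h : WalkPair μ W₁ W₂ M q δ) {t T t' : ℕ} (hA : DependsUpTo t T A)
    (ht : t < t') :
    pairProb μ W₁ W₂ (fun w₁ w₂ => A w₁ w₂ ∧ w₁ t' = w₁ t) ≤ δ * pairProb μ W₁ W₂ A := by
  obtain ⟨s, rfl⟩ : ∃ s, t' = t + s := ⟨t' - t, by omega⟩
  exact pairProb_and_le h.fst.measurable h.snd.measurable h.indep hA
    (B := {w | w (t + s) = w t})
    (measurableSet_eq_fun (measurable_pi_apply _) (measurable_pi_apply _))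
    fun p => h.fst.return_le t p s (by omega)

lemma return_snd (h : WalkPair μ W₁ W₂ M q δ) {t T t' : ℕ} (hA : DependsUpTo t T A)
    (ht : T < t') :
    pairProb μ W₁ W₂ (fun w₁ w₂ => A w₁ w₂ ∧ w₂ t' = w₂ T) ≤ δ * pairProb μ W₁ W₂ A :=
  h.swap.return_fst hA.swap ht

/-- The first walk is unlikely to be in a small set that was determined `M` steps before. -/
lemma mixing_fst_finset (h : WalkPair μ W₁ W₂ M q δ) (hq : 0 ≤ q) {t T t' : ℕ}
    (hA : DependsUpTo t T A)
    {S : (ℕ → V) → (ℕ → V) → Finset V} (hS : DependsUpTo t T S) (ht : t + M ≤ t') {β : ℝ}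
    (hβ : ∀ w₁ w₂, A w₁ w₂ → ((S w₁ w₂).card : ℝ) ≤ β) :
    pairProb μ W₁ W₂ (fun w₁ w₂ => A w₁ w₂ ∧ w₁ t' ∈ S w₁ w₂) ≤
      q * (β * pairProb μ W₁ W₂ A) := by
  classical
  have hAv : ∀ v, DependsUpTo t T fun w₁ w₂ => A w₁ w₂ ∧ v ∈ S w₁ w₂ := fun v =>
    hA.and (hS.comp fun s => v ∈ s)
  refine (pairProb_le_sum Finset.univ
    (B := fun v w₁ w₂ => (A w₁ w₂ ∧ v ∈ S w₁ w₂) ∧ w₁ t' = v)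
    fun w₁ w₂ hw => ⟨w₁ t', Finset.mem_univ _, hw, rfl⟩).trans ?_
  refine (Finset.sum_le_sum fun v _ => h.mixing_fst (hAv v) ht v).trans ?_
  rw [← Finset.mul_sum]
  -- The sum over `v` is the expected size of `S` on the event `A`.
  refine mul_le_mul_of_nonneg_left (sum_measureReal_le _ (fun v _ => h.measurableSet (hAv v))
    (h.measurableSet hA) (fun ω ⟨v, _, hv⟩ => hv.1) fun ω hω => ?_) hq
  refine le_trans ?_ (hβ _ _ hω)
  refine Nat.cast_le.2 (Finset.card_le_card fun v hv => ?_)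
  have hv' : ω ∈ pairEvent W₁ W₂ fun w₁ w₂ => A w₁ w₂ ∧ v ∈ S w₁ w₂ := (Finset.mem_filter.1 hv).2
  exact hv'.2

lemma mixing_snd_finset (h : WalkPair μ W₁ W₂ M q δ) (hq : 0 ≤ q) {t T t' : ℕ}
    (hA : DependsUpTo t T A)
    {S : (ℕ → V) → (ℕ → V) → Finset V} (hS : DependsUpTo t T S) (ht : T + M ≤ t') {β : ℝ}
    (hβ : ∀ w₁ w₂, A w₁ w₂ → ((S w₁ w₂).card : ℝ) ≤ β) :
    pairProb μ W₁ W₂ (fun w₁ w₂ => A w₁ w₂ ∧ w₂ t' ∈ S w₁ w₂) ≤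
      q * (β * pairProb μ W₁ W₂ A) :=
  h.swap.mixing_fst_finset hq hA.swap hS.swap ht fun w₁ w₂ => hβ w₂ w₁

end WalkPair

end TwoWalks

/-! ### Deterministic facts about the loads -/

section Loads

variable {V : Type*} {tie : TieRule V} {w₁ w₂ w₁' w₂' : ℕ → V}

lemma chosenBin_eq_or (t : ℕ) (q : V → ℕ) :
    chosenBin tie w₁ w₂ t q = w₁ t ∨ chosenBin tie w₁ w₂ t q = w₂ t := by
  unfold chosenBin; split_ifs <;> simp

lemma load_chosenBin_le_fst (t : ℕ) (q : V → ℕ) : q (chosenBin tie w₁ w₂ t q) ≤ q (w₁ t) := by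
  unfold chosenBin; split_ifs <;> omega

lemma load_chosenBin_le_snd (t : ℕ) (q : V → ℕ) : q (chosenBin tie w₁ w₂ t q) ≤ q (w₂ t) := by
  unfold chosenBin; split_ifs <;> omega

lemma chosenBin_congr {t : ℕ} (h₁ : ∀ s ≤ t, w₁ s = w₁' s) (h₂ : ∀ s ≤ t, w₂ s = w₂' s)
    (q : V → ℕ) : chosenBin tie w₁ w₂ t q = chosenBin tie w₁' w₂' t q := by
  have h : (fun s : Fin (t + 1) => (w₁ s, w₂ s)) = fun s : Fin (t + 1) => (w₁' s, w₂' s) := by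
    funext s
    rw [h₁ s (Nat.lt_succ_iff.1 s.2), h₂ s (Nat.lt_succ_iff.1 s.2)]
  unfold chosenBin
  rw [h, h₁ t le_rfl, h₂ t le_rfl]

open Classical in
lemma load_succ (t : ℕ) (v : V) : load tie w₁ w₂ (t + 1) v =
    load tie w₁ w₂ t v + if v = chosenBin tie w₁ w₂ t (load tie w₁ w₂ t) then 1 else 0 := rfl

lemma load_congr {t : ℕ} (h₁ : ∀ s < t, w₁ s = w₁' s) (h₂ : ∀ s < t, w₂ s = w₂' s) :
    load tie w₁ w₂ t = load tie w₁' w₂' t := by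
  induction t with
  | zero => rfl
  | succ t ih =>
    have h := ih (fun s hs => h₁ s (by omega)) fun s hs => h₂ s (by omega)
    funext v
    rw [load_succ, load_succ, h, chosenBin_congr (fun s hs => h₁ s (by omega)) fun s hs => h₂ s (by omega)]

lemma load_le_succ (t : ℕ) (v : V) : load tie w₁ w₂ t v ≤ load tie w₁ w₂ (t + 1) v := by
  rw [load_succ]; omega

lemma load_mono {s t : ℕ} (h : s ≤ t) (v : V) : load tie w₁ w₂ s v ≤ load tie w₁ w₂ t v :=
  monotone_nat_of_le_succ (f := fun t => load tie w₁ w₂ t v) (fun t => load_le_succ t v) h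

lemma exists_visit_of_load_lt {s t : ℕ} (h : s ≤ t) {v : V}
    (hv : load tie w₁ w₂ s v < load tie w₁ w₂ t v) :
    ∃ r, s ≤ r ∧ r < t ∧ (w₁ r = v ∨ w₂ r = v) := by
  induction t, h using Nat.le_induction with
  | base => exact absurd hv (lt_irrefl _)
  | succ t hst ih =>
    by_cases h : load tie w₁ w₂ s v < load tie w₁ w₂ t v
    · obtain ⟨r, h1, h2, h3⟩ := ih h
      exact ⟨r, h1, by omega, h3⟩
    · have hne : v = chosenBin tie w₁ w₂ t (load tie w₁ w₂ t) := by
        by_contra hne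
        rw [load_succ, if_neg hne] at hv
        exact h hv
      refine ⟨t, hst, by omega, ?_⟩
      rcases chosenBin_eq_or (tie := tie) (w₁ := w₁) (w₂ := w₂) t (load tie w₁ w₂ t) with e | e
      · exact .inl (e.symm.trans hne.symm)
      · exact .inr (e.symm.trans hne.symm)

lemma exists_chosenBin_eq_of_lt_load {T i : ℕ} {v : V} (h : i < load tie w₁ w₂ T v) :
    ∃ t < T, load tie w₁ w₂ t v = i ∧ chosenBin tie w₁ w₂ t (load tie w₁ w₂ t) = v := by
  induction T with
  | zero => simp [load] at h
  | succ T ih =>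
    by_cases h' : i < load tie w₁ w₂ T v
    · obtain ⟨t, ht, h⟩ := ih h'
      exact ⟨t, by omega, h⟩
    · rw [load_succ] at h
      split_ifs at h with hv
      · exact ⟨T, by omega, by omega, hv.symm⟩
      · omega

variable [Fintype V]

open Classical in
/-- The set of bins with at least `i` balls just before time `t`. -/
noncomputable def heavyBins (tie : TieRule V) (i t : ℕ) (w₁ w₂ : ℕ → V) : Finset V :=
  Finset.univ.filter fun v => i ≤ load tie w₁ w₂ t v

lemma mem_heavyBins {i t : ℕ} {v : V} :
    v ∈ heavyBins tie i t w₁ w₂ ↔ i ≤ load tie w₁ w₂ t v := by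
  simp [heavyBins]

/-- A random set of vertices which at each time is determined by the past, and which a vertex can
enter only while it is being visited. -/
structure GrowingSet (S : ℕ → (ℕ → V) → (ℕ → V) → Finset V) : Prop where
  dependsUpTo : ∀ t, DependsUpTo t t (S t)
  exists_visit : ∀ {s t w₁ w₂ v}, s ≤ t → v ∈ S t w₁ w₂ → v ∉ S s w₁ w₂ →
    ∃ r, s ≤ r ∧ r < t ∧ (w₁ r = v ∨ w₂ r = v)

lemma growingSet_heavyBins (tie : TieRule V) (i : ℕ) : GrowingSet (heavyBins tie i) where
  dependsUpTo t w₁ w₁' w₂ w₂' h₁ h₂ := by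
    ext v
    rw [mem_heavyBins, mem_heavyBins, load_congr (fun s hs => h₁ s hs.le) fun s hs => h₂ s hs.le]
  exists_visit {s t w₁ w₂ v} hst h h' := by
    rw [mem_heavyBins] at h h'
    exact exists_visit_of_load_lt (tie := tie) hst (by omega)

lemma GrowingSet.swap {S : ℕ → (ℕ → V) → (ℕ → V) → Finset V} (h : GrowingSet S) :
    GrowingSet fun t w₁ w₂ => S t w₂ w₁ where
  dependsUpTo t := (h.dependsUpTo t).swap
  exists_visit hst h1 h2 := by
    obtain ⟨r, hr, hr', h⟩ := h.exists_visit hst h1 h2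
    exact ⟨r, hr, hr', h.symm⟩

lemma card_heavyBins_mono {i s t : ℕ} (h : s ≤ t) :
    (heavyBins tie i s w₁ w₂).card ≤ (heavyBins tie i t w₁ w₂).card :=
  Finset.card_le_card fun v hv =>
    mem_heavyBins.2 ((mem_heavyBins.1 hv).trans (load_mono h v))

lemma sum_load (T : ℕ) : ∑ v, load tie w₁ w₂ T v = T := by
  classical
  induction T with
  | zero => simp [load]
  | succ T ih => simp [load, Finset.sum_add_distrib, ih]

lemma mul_card_heavyBins_le (i T : ℕ) : i * (heavyBins tie i T w₁ w₂).card ≤ T := by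
  conv_rhs => rw [← sum_load (tie := tie) (w₁ := w₁) (w₂ := w₂) T]
  rw [mul_comm, ← smul_eq_mul, ← Finset.sum_const]
  exact (Finset.sum_le_sum fun v hv => mem_heavyBins.1 hv).trans
    (Finset.sum_le_sum_of_subset (Finset.subset_univ _))

/-- At time `u + M`, the vertex `x` has been visited since time `u`. -/
def RecentVisit (M u : ℕ) (w₁ w₂ : ℕ → V) (x : V) : Prop :=
  ∃ s, u ≤ s ∧ s < u + M ∧ (w₁ s = x ∨ w₂ s = x)

/-- At time `u + M`, one of the walks is at a vertex visited since time `u`. -/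
def RecentHit (M u : ℕ) (w₁ w₂ : ℕ → V) : Prop :=
  RecentVisit M u w₁ w₂ (w₁ (u + M)) ∨ RecentVisit M u w₁ w₂ (w₂ (u + M))

/-- At time `u + M`, both walks are in a set that had at most `β` elements at time `u`. -/
def BothHit (S : ℕ → (ℕ → V) → (ℕ → V) → Finset V) (β : ℝ) (M u : ℕ) (w₁ w₂ : ℕ → V) : Prop :=
  ((S u w₁ w₂).card : ℝ) ≤ β ∧ w₁ (u + M) ∈ S u w₁ w₂ ∧ w₂ (u + M) ∈ S u w₁ w₂

open Classical in
-- Assign to each bin of level `i + 1` the time of the ball that raised it from `i`. As the less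
-- loaded bin was chosen, both walks were then at bins with at least `i` balls. A vertex that became
-- so heavy only after time `u` was visited since, which is a recent hit.
lemma card_heavyBins_succ_le {i T M : ℕ} {β : ℝ} (h : ((heavyBins tie i T w₁ w₂).card : ℝ) ≤ β) :
    (heavyBins tie (i + 1) T w₁ w₂).card ≤ M +
      ((Finset.range T).filter fun u => RecentHit M u w₁ w₂).card +
      ((Finset.range T).filter fun u => BothHit (heavyBins tie i) β M u w₁ w₂).card := by
  set R := (Finset.range T).filter fun u => RecentHit M u w₁ w₂ with hR
  set B := (Finset.range T).filter fun u => BothHit (heavyBins tie i) β M u w₁ w₂ with hB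
  set c := fun t => chosenBin tie w₁ w₂ t (load tie w₁ w₂ t) with hc
  set X := (Finset.range T).filter fun t => load tie w₁ w₂ t (c t) = i with hX
  have h1 : heavyBins tie (i + 1) T w₁ w₂ ⊆ X.image c := fun v hv => by
    obtain ⟨t, ht, hl, hcb⟩ := exists_chosenBin_eq_of_lt_load (mem_heavyBins.1 hv)
    exact Finset.mem_image.2 ⟨t, by simp [hX, hc, hcb, ht, hl], hcb⟩
  have h2 : X ⊆ Finset.range M ∪ R.image (· + M) ∪ B.image (· + M) := fun t ht => by
    simp only [hX, Finset.mem_filter, Finset.mem_range] at ht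
    obtain ⟨htT, htl⟩ := ht
    rcases Nat.lt_or_ge t M with htM | htM
    · exact Finset.mem_union_left _ (Finset.mem_union_left _ (Finset.mem_range.2 htM))
    obtain ⟨u, rfl⟩ : ∃ u, t = u + M := ⟨t - M, by omega⟩
    by_cases hrec : RecentHit M u w₁ w₂
    · refine Finset.mem_union_left _ (Finset.mem_union_right _ (Finset.mem_image.2 ⟨u, ?_, rfl⟩))
      simp only [hR, Finset.mem_filter, Finset.mem_range]
      exact ⟨by omega, hrec⟩
    · refine Finset.mem_union_right _ (Finset.mem_image.2 ⟨u, ?_, rfl⟩)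
      simp only [hB, Finset.mem_filter, Finset.mem_range]
      have hold : ∀ x, i ≤ load tie w₁ w₂ (u + M) x → ¬ RecentVisit M u w₁ w₂ x →
          x ∈ heavyBins tie i u w₁ w₂ := fun x hx hnr => by
        by_contra hx'
        exact hnr ((growingSet_heavyBins tie i).exists_visit (Nat.le_add_right u M)
          (mem_heavyBins.2 hx) hx')
      have hc1 := load_chosenBin_le_fst (tie := tie) (w₁ := w₁) (w₂ := w₂) (u + M)
        (load tie w₁ w₂ (u + M))
      have hc2 := load_chosenBin_le_snd (tie := tie) (w₁ := w₁) (w₂ := w₂) (u + M)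
        (load tie w₁ w₂ (u + M))
      refine ⟨by omega, ?_, hold _ (htl.symm.le.trans hc1) fun h => hrec (.inl h),
        hold _ (htl.symm.le.trans hc2) fun h => hrec (.inr h)⟩
      exact le_trans (by exact_mod_cast card_heavyBins_mono (by omega)) h
  calc _ ≤ (X.image c).card := Finset.card_le_card h1
    _ ≤ X.card := Finset.card_image_le
    _ ≤ _ := Finset.card_le_card h2
    _ ≤ _ := (Finset.card_union_le _ _).trans (Nat.add_le_add ((Finset.card_union_le _ _).trans
      (Nat.add_le_add (Finset.card_range M).le Finset.card_image_le)) Finset.card_image_le)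

/-- The first walk is at `v` at time `t`, and was there at `j` earlier times; at each of these
times except for the first one the second walk was in a growing set that never had more than
`β` elements. -/
def HitChain (S : ℕ → (ℕ → V) → (ℕ → V) → Finset V) (β : ℝ) :
    ℕ → V → ℕ → (ℕ → V) → (ℕ → V) → Prop
  | 0, v, t, w₁, _ => w₁ t = v
  | j + 1, v, t', w₁, w₂ => ∃ t < t', HitChain S β j v t w₁ w₂ ∧ w₁ t' = v ∧
      w₂ t' ∈ S t' w₁ w₂ ∧ ∀ s ≤ t', ((S s w₁ w₂).card : ℝ) ≤ β

variable {S : ℕ → (ℕ → V) → (ℕ → V) → Finset V} {β : ℝ}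

lemma HitChain.eq {j t : ℕ} {v : V} (h : HitChain S β j v t w₁ w₂) : w₁ t = v := by
  cases j with
  | zero => exact h
  | succ j => obtain ⟨_, _, _, h, _⟩ := h; exact h

lemma dependsUpTo_hitChain (hS : GrowingSet S) (j : ℕ) (v : V) (t : ℕ) :
    DependsUpTo t t (HitChain S β j v t) := by
  have key : ∀ j t w₁ w₁' w₂ w₂', (∀ s ≤ t, w₁ s = w₁' s) → (∀ s ≤ t, w₂ s = w₂' s) →
      HitChain S β j v t w₁ w₂ → HitChain S β j v t w₁' w₂' := by
    intro j
    induction j with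
    | zero => intro t w₁ w₁' w₂ w₂' h₁ _ h; exact (h₁ t le_rfl).symm.trans h
    | succ j ih =>
      rintro t' w₁ w₁' w₂ w₂' h₁ h₂ ⟨t, ht, hc, hv, hm, hb⟩
      have hSeq : ∀ s ≤ t', S s w₁ w₂ = S s w₁' w₂' := fun s hs =>
        hS.dependsUpTo s _ _ _ _ (fun r hr => h₁ r (hr.trans hs)) fun r hr => h₂ r (hr.trans hs)
      refine ⟨t, ht, ih t _ _ _ _ (fun s hs => h₁ s (by omega)) (fun s hs => h₂ s (by omega)) hc,
        (h₁ t' le_rfl).symm.trans hv, ?_, fun s hs => ?_⟩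
      · rw [← hSeq t' le_rfl, ← h₂ t' le_rfl]; exact hm
      · rw [← hSeq s hs]; exact hb s hs
  exact fun w₁ w₁' w₂ w₂' h₁ h₂ => propext ⟨key j t _ _ _ _ h₁ h₂,
    key j t _ _ _ _ (fun s hs => (h₁ s hs).symm) fun s hs => (h₂ s hs).symm⟩

/-- Remove the last time of `F` and recurse. The first link of a chain carries no condition on the
second walk, hence `j < F.card`. -/
lemma exists_hitChain {T : ℕ} {v : V} (hb : ∀ s < T, ((S s w₁ w₂).card : ℝ) ≤ β) (j : ℕ)
    {F : Finset ℕ} (hF : ∀ t ∈ F, t < T ∧ w₁ t = v ∧ w₂ t ∈ S t w₁ w₂) (hj : j < F.card) :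
    ∃ t ∈ F, (∀ s ∈ F, s ≤ t) ∧ HitChain S β j v t w₁ w₂ := by
  induction j generalizing F with
  | zero =>
    have hne : F.Nonempty := Finset.card_pos.1 hj
    exact ⟨F.max' hne, F.max'_mem hne, fun s hs => F.le_max' s hs, (hF _ (F.max'_mem hne)).2.1⟩
  | succ j ih =>
    have hne : F.Nonempty := Finset.card_pos.1 (by omega)
    have hm := F.max'_mem hne
    obtain ⟨t, ht, -, hc⟩ := ih (F := F.erase (F.max' hne))
      (fun t ht => hF t (Finset.mem_of_mem_erase ht)) (by rw [Finset.card_erase_of_mem hm]; omega)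
    have hlt : t < F.max' hne := F.lt_max'_of_mem_erase_max' hne ht
    obtain ⟨h1, h2, h3⟩ := hF _ hm
    exact ⟨F.max' hne, hm, fun s hs => F.le_max' s hs, t, hlt, hc, h2, h3,
      fun s hs => hb s (by omega)⟩

open Classical in
-- Once `v` has `L` balls, it receives another only if the other walk is also at a bin with at least
-- `L` balls.
lemma load_le_add_card (L T : ℕ) (v : V) : load tie w₁ w₂ T v ≤ L +
    ((Finset.range T).filter fun t => w₁ t = v ∧ w₂ t ∈ heavyBins tie L t w₁ w₂).card +
    ((Finset.range T).filter fun t => w₂ t = v ∧ w₁ t ∈ heavyBins tie L t w₁ w₂).card := by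
  induction T with
  | zero => simp [load]
  | succ T ih =>
    rw [Finset.range_add_one, Finset.filter_insert, Finset.filter_insert]
    have n1 : T ∉ (Finset.range T).filter fun t => w₁ t = v ∧ w₂ t ∈ heavyBins tie L t w₁ w₂ := by
      simp
    have n2 : T ∉ (Finset.range T).filter fun t => w₂ t = v ∧ w₁ t ∈ heavyBins tie L t w₁ w₂ := by
      simp
    have hle1 : ∀ (P : Prop) [Decidable P] (F : Finset ℕ), T ∉ F →
        (if P then insert T F else F).card = F.card + if P then 1 else 0 := by
      intro P _ F hF
      split_ifs
      · exact Finset.card_insert_of_notMem hF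
      · rfl
    rw [hle1 _ _ n1, hle1 _ _ n2, load_succ]
    split_ifs with hv hA hB hB <;> try omega
    rcases Nat.lt_or_ge (load tie w₁ w₂ T v) L with hL | hL
    · omega
    · exfalso
      have h1 := load_chosenBin_le_fst (tie := tie) (w₁ := w₁) (w₂ := w₂) T (load tie w₁ w₂ T)
      have h2 := load_chosenBin_le_snd (tie := tie) (w₁ := w₁) (w₂ := w₂) T (load tie w₁ w₂ T)
      rw [← hv] at h1 h2
      rcases chosenBin_eq_or (tie := tie) (w₁ := w₁) (w₂ := w₂) T (load tie w₁ w₂ T) with e | e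
      · exact hA ⟨by rw [← e, ← hv], mem_heavyBins.2 (hL.trans h2)⟩
      · exact hB ⟨by rw [← e, ← hv], mem_heavyBins.2 (hL.trans h1)⟩

/-- A bin that gets many more than `L` balls is hit repeatedly by one walk while the other walk is
at a bin with at least `L` balls. -/
lemma exists_hitChain_of_lt_load {L T h : ℕ} {v : V}
    (hb : ((heavyBins tie L T w₁ w₂).card : ℝ) ≤ β) (hv : L + 2 * h < load tie w₁ w₂ T v) :
    (∃ t < T, HitChain (heavyBins tie L) β h v t w₁ w₂) ∨
      ∃ t < T, HitChain (fun t w₁ w₂ => heavyBins tie L t w₂ w₁) β h v t w₂ w₁ := by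
  classical
  have hle := load_le_add_card (tie := tie) (w₁ := w₁) (w₂ := w₂) L T v
  have hb' : ∀ s < T, ((heavyBins tie L s w₁ w₂).card : ℝ) ≤ β := fun s hs =>
    le_trans (by exact_mod_cast card_heavyBins_mono hs.le) hb
  -- More than `2 * h` balls above level `L` force one of the two counts above `h`.
  rcases Nat.lt_or_ge h ((Finset.range T).filter
    fun t => w₁ t = v ∧ w₂ t ∈ heavyBins tie L t w₁ w₂).card with h1 | h1
  · left
    obtain ⟨t, ht, -, hc⟩ := exists_hitChain hb' h (fun t ht => by simpa using ht) h1
    exact ⟨t, by simp at ht; exact ht.1, hc⟩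
  · right
    obtain ⟨t, ht, -, hc⟩ := exists_hitChain (S := fun t w₁ w₂ => heavyBins tie L t w₂ w₁)
      (w₁ := w₂) (w₂ := w₁) (F := (Finset.range T).filter
        fun t => w₂ t = v ∧ w₁ t ∈ heavyBins tie L t w₁ w₂) hb' h
      (fun t ht => by simpa using ht) (by omega)
    exact ⟨t, by simp at ht; exact ht.1, hc⟩

end Loads

/-! ### Probabilities of recent hits, double hits and hit chains -/

section Phases

variable {V Ω : Type*} [MeasurableSpace Ω] [MeasurableSpace V] [DiscreteMeasurableSpace V]
  [Fintype V] {μ : Measure Ω} [IsProbabilityMeasure μ] {W₁ W₂ : ℕ → Ω → V}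
  {A : (ℕ → V) → (ℕ → V) → Prop} {M : ℕ} {q δ : ℝ}
  {S : ℕ → (ℕ → V) → (ℕ → V) → Finset V} {β : ℝ}

lemma dependsUpTo_const {α : Type*} (t T : ℕ) (a : α) :
    DependsUpTo t T fun (_ : ℕ → V) (_ : ℕ → V) => a :=
  fun _ _ _ _ _ _ => rfl

namespace WalkPair

/-- For each recent time `s` there are two cases. If the second walk returns to its own position,
reveal it completely first (factor `δ`), then let the first walk mix to `v`. If it meets an old
position of the first walk, reveal the first walk completely, then let the second one mix to a
single vertex. -/
lemma prob_recentVisit_snd_le (h : WalkPair μ W₁ W₂ M q δ) (hq : 0 ≤ q) {u : ℕ}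
    (hA : DependsUpTo u u A) (v : V) :
    pairProb μ W₁ W₂ (fun w₁ w₂ => A w₁ w₂ ∧ w₁ (u + M) = v ∧
      RecentVisit M u w₁ w₂ (w₂ (u + M))) ≤ q * (M * (δ + q)) * pairProb μ W₁ W₂ A := by
  classical
  have hP : 0 ≤ pairProb μ W₁ W₂ A := pairProb_nonneg
  refine (pairProb_le_sum (Finset.Ico u (u + M))
    (B := fun s w₁ w₂ => A w₁ w₂ ∧ w₁ (u + M) = v ∧ (w₁ s = w₂ (u + M) ∨ w₂ s = w₂ (u + M)))
    fun w₁ w₂ ⟨hw, hv, s, hs, hs', e⟩ => ⟨s, Finset.mem_Ico.2 ⟨hs, hs'⟩, hw, hv, e⟩).trans ?_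
  have key : ∀ s ∈ Finset.Ico u (u + M), pairProb μ W₁ W₂ (fun w₁ w₂ => A w₁ w₂ ∧
      w₁ (u + M) = v ∧ (w₁ s = w₂ (u + M) ∨ w₂ s = w₂ (u + M))) ≤
      q * (δ + q) * pairProb μ W₁ W₂ A := by
    intro s hs
    obtain ⟨hs1, hs2⟩ := Finset.mem_Ico.1 hs
    refine (pairProb_le_add
      (B := fun w₁ w₂ => (A w₁ w₂ ∧ w₂ (u + M) = w₂ s) ∧ w₁ (u + M) = v)
      (C := fun w₁ w₂ => (A w₁ w₂ ∧ w₁ (u + M) = v) ∧ w₂ (u + M) ∈ ({w₁ s} : Finset V))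
      ?_).trans ?_
    · rintro w₁ w₂ ⟨hw, hv, e | e⟩
      · exact .inr ⟨⟨hw, hv⟩, by simp [e]⟩
      · exact .inl ⟨⟨hw, e.symm⟩, hv⟩
    have d1 : DependsUpTo u (u + M) fun w₁ w₂ => A w₁ w₂ ∧ w₂ (u + M) = w₂ s :=
      (hA.mono le_rfl (by omega)).and fun _ _ _ _ _ h₂ => by
        rw [h₂ s hs2.le, h₂ (u + M) le_rfl]
    have d2 : DependsUpTo (u + M) u fun w₁ w₂ => A w₁ w₂ ∧ w₁ (u + M) = v :=
      (hA.mono (by omega) le_rfl).and ((dependsUpTo_fst le_rfl u).comp fun x => x = v)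
    have d3 : DependsUpTo (u + M) u fun (w₁ : ℕ → V) (_ : ℕ → V) => ({w₁ s} : Finset V) :=
      (dependsUpTo_fst hs2.le u).comp fun x => ({x} : Finset V)
    have p1 := h.mixing_fst d1 le_rfl v
    have p2 := h.return_snd (hA.mono le_rfl hs1) (by omega : s < u + M)
    have p3 := h.mixing_snd_finset hq d2 d3 le_rfl (β := 1) (fun _ _ _ => by simp)
    have p4 := h.mixing_fst hA le_rfl v
    have p5 := mul_le_mul_of_nonneg_left p2 hq
    have p6 := mul_le_mul_of_nonneg_left p4 hq
    linarith
  refine (Finset.sum_le_sum key).trans_eq ?_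
  rw [Finset.sum_const, Nat.card_Ico, nsmul_eq_mul, Nat.add_sub_cancel_left]
  ring

/-- Summing over the `n` positions of the other walk loses only a constant, since `q` will be `2 /
n`. -/
lemma prob_recentHit_le (h : WalkPair μ W₁ W₂ M q δ) (hq : 0 ≤ q) (hδ : 0 ≤ δ) (u : ℕ) :
    pairProb μ W₁ W₂ (RecentHit M u) ≤ 2 * (Fintype.card V * (q * (M * (δ + q)))) := by
  have key : ∀ {W₁ W₂ : ℕ → Ω → V}, WalkPair μ W₁ W₂ M q δ →
      pairProb μ W₁ W₂ (fun w₁ w₂ => RecentVisit M u w₁ w₂ (w₂ (u + M))) ≤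
        Fintype.card V * (q * (M * (δ + q))) := by
    intro W₁ W₂ h
    refine (pairProb_le_sum Finset.univ (B := fun v w₁ w₂ => True ∧ w₁ (u + M) = v ∧
      RecentVisit M u w₁ w₂ (w₂ (u + M))) fun w₁ w₂ hw =>
        ⟨w₁ (u + M), Finset.mem_univ _, trivial, rfl, hw⟩).trans ?_
    have hc : 0 ≤ q * (M * (δ + q)) := by positivity
    refine (Finset.sum_le_sum fun v _ =>
      (h.prob_recentVisit_snd_le hq (dependsUpTo_const u u True) v).trans
        (mul_le_of_le_one_right hc pairProb_le_one)).trans_eq ?_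
    simp
  have h1 := key h
  have h2 := key h.swap
  refine (pairProb_le_add fun w₁ w₂ hw => Or.symm hw).trans ?_
  have e : pairProb μ W₁ W₂ (fun w₁ w₂ => RecentVisit M u w₁ w₂ (w₁ (u + M))) ≤
      pairProb μ W₂ W₁ (fun w₁ w₂ => RecentVisit M u w₁ w₂ (w₂ (u + M))) := by
    rw [← pairProb_swap]
    exact pairProb_mono fun w₁ w₂ ⟨s, hs, hs', h⟩ => ⟨s, hs, hs', h.symm⟩
  linarith

/-- The set is frozen at time `u`, and both walks then have `M` steps to mix, independently. -/
lemma prob_bothHit_le (h : WalkPair μ W₁ W₂ M q δ) (hq : 0 ≤ q) (hβ : 0 ≤ β)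
    (hS : GrowingSet S) (u : ℕ) :
    pairProb μ W₁ W₂ (BothHit S β M u) ≤ (q * β) ^ 2 := by
  have d1 : DependsUpTo u u fun w₁ w₂ => ((S u w₁ w₂).card : ℝ) ≤ β :=
    (hS.dependsUpTo u).comp fun s => (s.card : ℝ) ≤ β
  have d2 : DependsUpTo (u + M) u fun w₁ w₂ => ((S u w₁ w₂).card : ℝ) ≤ β ∧
      w₁ (u + M) ∈ S u w₁ w₂ := fun w₁ w₁' w₂ w₂' h₁ h₂ => by
    beta_reduce
    rw [hS.dependsUpTo u w₁ w₁' w₂ w₂' (fun s hs => h₁ s (by omega)) h₂, h₁ (u + M) le_rfl]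
  have p1 := h.mixing_fst_finset hq d1 (hS.dependsUpTo u) (le_refl (u + M)) fun _ _ h => h
  have p2 := h.mixing_snd_finset hq d2 ((hS.dependsUpTo u).mono (by omega) le_rfl)
    (le_refl (u + M)) fun _ _ h => h.1
  refine (pairProb_mono fun w₁ w₂ hw => (⟨⟨hw.1, hw.2.1⟩, hw.2.2⟩ : (_ ∧ _) ∧ _)).trans
    (p2.trans ?_)
  have p3 := p1.trans (mul_le_mul_of_nonneg_left
    (mul_le_mul_of_nonneg_left (pairProb_le_one (μ := μ) (W₁ := W₁) (W₂ := W₂)) hβ) hq)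
  rw [mul_one] at p3
  rw [sq]
  rw [← mul_assoc]
  exact mul_le_mul_of_nonneg_left p3 (mul_nonneg hq hβ)

/-- The expected number of ways to continue a hit chain by one step. -/
lemma sum_prob_hitChain_succ_le (h : WalkPair μ W₁ W₂ M q δ) (hq : 0 ≤ q) (hδ : 0 ≤ δ)
    (hβ : 0 ≤ β) (hS : GrowingSet S) (j : ℕ) (v : V) (T t : ℕ) :
    ∑ t' ∈ Finset.range T, pairProb μ W₁ W₂ (fun w₁ w₂ => t < t' ∧ HitChain S β j v t w₁ w₂ ∧
      w₁ t' = v ∧ w₂ t' ∈ S t' w₁ w₂ ∧ ∀ s ≤ t', ((S s w₁ w₂).card : ℝ) ≤ β) ≤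
    (M * δ + T * (q * (q * β) + q * (M * (δ + q)))) *
      pairProb μ W₁ W₂ (HitChain S β j v t) := by
  classical
  set P := pairProb μ W₁ W₂ (HitChain S β j v t) with hPdef
  have hP : 0 ≤ P := pairProb_nonneg
  set c := q * (q * β) + q * (M * (δ + q)) with hcdef
  have hc : 0 ≤ c := by positivity
  have hE := dependsUpTo_hitChain (β := β) hS j v t
  have key : ∀ t' ∈ Finset.range T, pairProb μ W₁ W₂ (fun w₁ w₂ => t < t' ∧
      HitChain S β j v t w₁ w₂ ∧
      w₁ t' = v ∧ w₂ t' ∈ S t' w₁ w₂ ∧ ∀ s ≤ t', ((S s w₁ w₂).card : ℝ) ≤ β) ≤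
      (if t' ∈ Finset.Ico t (t + M) then δ * P else 0) + c * P := by
    intro t' _
    have hcP : 0 ≤ c * P := mul_nonneg hc hP
    rcases Nat.lt_or_ge t t' with ht | ht
    swap
    · refine le_trans (le_of_eq ?_) (add_nonneg (by split_ifs <;> positivity) hcP)
      have : pairEvent W₁ W₂ (fun w₁ w₂ => t < t' ∧ HitChain S β j v t w₁ w₂ ∧
          w₁ t' = v ∧ w₂ t' ∈ S t' w₁ w₂ ∧ ∀ s ≤ t', ((S s w₁ w₂).card : ℝ) ≤ β) = ∅ :=
        Set.eq_empty_of_forall_notMem fun ω hω => absurd hω.1 (not_lt.2 ht)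
      rw [pairProb, this, measureReal_empty]
    rcases Nat.lt_or_ge t' (t + M) with htM | htM
    -- Too early for mixing: only the return of the first walk is used. There are at most `M` such
    -- times.
    · rw [if_pos (Finset.mem_Ico.2 ⟨ht.le, htM⟩)]
      refine le_trans ?_ (le_add_of_nonneg_right hcP)
      exact (pairProb_mono fun w₁ w₂ hw =>
        (⟨hw.2.1, hw.2.2.1.trans hw.2.1.eq.symm⟩ : _ ∧ _)).trans (h.return_fst hE ht)
    · refine le_trans ?_ (le_add_of_nonneg_left (by split_ifs <;> positivity))
      -- Late enough: freeze the set at `u`. The second walk hits the frozen set, or a vertex that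
      -- entered it since and so was visited recently.
      obtain ⟨u, rfl⟩ : ∃ u, t' = u + M := ⟨t' - M, by omega⟩
      have htu : t ≤ u := by omega
      have hE' := hE.mono htu htu
      have d1 : DependsUpTo u u fun w₁ w₂ => HitChain S β j v t w₁ w₂ ∧
          ((S u w₁ w₂).card : ℝ) ≤ β :=
        hE'.and ((hS.dependsUpTo u).comp fun s => (s.card : ℝ) ≤ β)
      have d2 : DependsUpTo (u + M) u fun w₁ w₂ => (HitChain S β j v t w₁ w₂ ∧
          ((S u w₁ w₂).card : ℝ) ≤ β) ∧ w₁ (u + M) = v :=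
        (d1.mono (by omega) le_rfl).and ((dependsUpTo_fst le_rfl u).comp fun x => x = v)
      have p1 := h.mixing_fst d1 (le_refl (u + M)) v
      have p2 := h.mixing_snd_finset hq d2 ((hS.dependsUpTo u).mono (by omega) le_rfl)
        (le_refl (u + M)) fun _ _ h => h.1.2
      have p3 := h.prob_recentVisit_snd_le hq hE' v
      have p4 : pairProb μ W₁ W₂ (fun w₁ w₂ => HitChain S β j v t w₁ w₂ ∧
          ((S u w₁ w₂).card : ℝ) ≤ β) ≤ P := pairProb_mono fun _ _ h => h.1
      refine (pairProb_le_add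
        (B := fun w₁ w₂ => ((HitChain S β j v t w₁ w₂ ∧ ((S u w₁ w₂).card : ℝ) ≤ β) ∧
          w₁ (u + M) = v) ∧ w₂ (u + M) ∈ S u w₁ w₂)
        (C := fun w₁ w₂ => HitChain S β j v t w₁ w₂ ∧ w₁ (u + M) = v ∧
          RecentVisit M u w₁ w₂ (w₂ (u + M))) ?_).trans ?_
      · rintro w₁ w₂ ⟨-, hw, hv, hm, hb⟩
        by_cases hm' : w₂ (u + M) ∈ S u w₁ w₂
        · exact .inl ⟨⟨⟨hw, hb u (by omega)⟩, hv⟩, hm'⟩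
        · exact .inr ⟨hw, hv, hS.exists_visit (by omega) hm hm'⟩
      · have p5 := mul_le_mul_of_nonneg_left (p1.trans (mul_le_mul_of_nonneg_left p4 hq))
          (mul_nonneg hq hβ)
        rw [hcdef]
        linarith
  refine (Finset.sum_le_sum key).trans ?_
  rw [Finset.sum_add_distrib, Finset.sum_const, Finset.card_range, nsmul_eq_mul]
  rw [show (M * δ + T * c) * P = M * δ * P + T * (c * P) by ring]
  refine add_le_add_left ?_ _
  rw [← Finset.sum_filter, Finset.sum_const, nsmul_eq_mul, mul_assoc]
  have : ((Finset.range T).filter fun t' => t' ∈ Finset.Ico t (t + M)).card ≤ M := by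
    refine (Finset.card_le_card (t := Finset.Ico t (t + M)) fun x hx =>
      (Finset.mem_filter.1 hx).2).trans ?_
    simp
  exact mul_le_mul_of_nonneg_right (by exact_mod_cast this) (mul_nonneg hδ hP)

/-- Each link multiplies the expected number of chains by the same factor. Initially there are `T`,
since the time determines the vertex `v`. -/
lemma sum_prob_hitChain_le (h : WalkPair μ W₁ W₂ M q δ) (hq : 0 ≤ q) (hδ : 0 ≤ δ)
    (hβ : 0 ≤ β) (hS : GrowingSet S) (j T : ℕ) :
    ∑ v, ∑ t ∈ Finset.range T, pairProb μ W₁ W₂ (HitChain S β j v t) ≤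
      (M * δ + T * (q * (q * β) + q * (M * (δ + q)))) ^ j * T := by
  classical
  have hD : 0 ≤ M * δ + T * (q * (q * β) + q * (M * (δ + q))) := by positivity
  induction j with
  | zero =>
    rw [Finset.sum_comm, pow_zero, one_mul]
    refine (Finset.sum_le_sum (g := fun _ => (1 : ℝ)) fun t _ => ?_).trans_eq (by simp)
    have := sum_measureReal_le (μ := μ) Finset.univ (β := 1) (A := Set.univ)
      (B := fun v => pairEvent W₁ W₂ (HitChain S β 0 v t))
      (fun v _ => h.measurableSet (dependsUpTo_hitChain hS 0 v t)) MeasurableSet.univ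
      (fun _ _ => trivial) fun ω _ => by
        have hle : (Finset.univ.filter
            fun v => ω ∈ pairEvent W₁ W₂ (HitChain S β 0 v t)).card ≤ 1 :=
          Finset.card_le_one.2 fun a ha b hb =>
            (Finset.mem_filter.1 ha).2.symm.trans (Finset.mem_filter.1 hb).2
        exact_mod_cast hle
    rw [probReal_univ, mul_one] at this
    exact this
  | succ j ih =>
    rw [pow_succ', mul_assoc]
    refine le_trans ?_ (mul_le_mul_of_nonneg_left ih hD)
    rw [Finset.mul_sum]
    refine Finset.sum_le_sum fun v _ => ?_
    rw [Finset.mul_sum]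
    refine le_trans (Finset.sum_le_sum fun t' ht' => ?_) ((Finset.sum_comm).trans_le
      (Finset.sum_le_sum fun t _ => h.sum_prob_hitChain_succ_le hq hδ hβ hS j v T t))
    refine pairProb_le_sum _ fun w₁ w₂ ⟨t, ht, hw⟩ => ⟨t, ?_, ht, hw⟩
    rw [Finset.mem_range] at ht' ⊢
    omega

lemma prob_exists_hitChain_le (h : WalkPair μ W₁ W₂ M q δ) (hq : 0 ≤ q) (hδ : 0 ≤ δ)
    (hβ : 0 ≤ β) (hS : GrowingSet S) (j T : ℕ) :
    pairProb μ W₁ W₂ (fun w₁ w₂ => ∃ v, ∃ t < T, HitChain S β j v t w₁ w₂) ≤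
      (M * δ + T * (q * (q * β) + q * (M * (δ + q)))) ^ j * T := by
  refine le_trans ?_ (h.sum_prob_hitChain_le hq hδ hβ hS j T)
  refine (pairProb_le_sum Finset.univ (B := fun v w₁ w₂ => ∃ t < T, HitChain S β j v t w₁ w₂)
    fun w₁ w₂ ⟨v, hv⟩ => ⟨v, Finset.mem_univ v, hv⟩).trans ?_
  exact Finset.sum_le_sum fun v _ => pairProb_le_sum _ fun w₁ w₂ ⟨t, ht, hw⟩ =>
    ⟨t, Finset.mem_range.2 ht, hw⟩

open Classical in
lemma prob_card_recentHit_ge_le (h : WalkPair μ W₁ W₂ M q δ) (hq : 0 ≤ q) (hδ : 0 ≤ δ) (T : ℕ)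
    (a : ℝ) :
    a * pairProb μ W₁ W₂ (fun w₁ w₂ =>
      a ≤ (((Finset.range T).filter fun u => RecentHit M u w₁ w₂).card : ℝ)) ≤
    T * (2 * (Fintype.card V * (q * (M * (δ + q))))) := by
  refine (mul_measureReal_card_ge_le (Finset.range T)
    (B := fun u => pairEvent W₁ W₂ (RecentHit M u)) (fun u _ => ?_) a).trans
    ((Finset.sum_le_sum fun u _ => h.prob_recentHit_le hq hδ u).trans_eq (by simp))
  refine h.measurableSet (t := u + M) (T := u + M) fun w₁ w₁' w₂ w₂' h₁ h₂ => ?_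
  unfold RecentHit RecentVisit
  rw [h₁ _ le_rfl, h₂ _ le_rfl]
  refine propext (or_congr ?_ ?_) <;>
  · refine exists_congr fun s => and_congr_right fun _ => and_congr_right fun hs => ?_
    rw [h₁ s hs.le, h₂ s hs.le]

open Classical in
lemma prob_card_bothHit_ge_le (h : WalkPair μ W₁ W₂ M q δ) (hq : 0 ≤ q) (hβ : 0 ≤ β)
    (hS : GrowingSet S) (T : ℕ) (a : ℝ) :
    a * pairProb μ W₁ W₂ (fun w₁ w₂ =>
      a ≤ (((Finset.range T).filter fun u => BothHit S β M u w₁ w₂).card : ℝ)) ≤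
    T * (q * β) ^ 2 := by
  refine (mul_measureReal_card_ge_le (Finset.range T)
    (B := fun u => pairEvent W₁ W₂ (BothHit S β M u)) (fun u _ => ?_) a).trans
    ((Finset.sum_le_sum fun u _ => h.prob_bothHit_le hq hβ hS u).trans_eq (by simp))
  refine h.measurableSet (t := u + M) (T := u + M) fun w₁ w₁' w₂ w₂' h₁ h₂ => ?_
  unfold BothHit
  rw [h₁ _ le_rfl, h₂ _ le_rfl, hS.dependsUpTo u w₁ w₁' w₂ w₂' (fun s hs => h₁ s (by omega))
    fun s hs => h₂ s (by omega)]

end WalkPair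

end Phases

/-! ### Layered induction and the bound on the maximum load -/

section MaxLoad

/-- The fraction of bins that may have `j` balls more than in the first stage considered. -/
noncomputable def heavyFraction (K ξ : ℝ) (j : ℕ) : ℝ :=
  (1 / 2) ^ (2 ^ j) / (16 * (K * 2 ^ j)) + 2 * ξ

/-- With `c = K * 2 ^ j`, the main term `e` of `heavyFraction` satisfies the recursion `8 * c * e ^
2` exactly. Using `(e + 2 * ξ) ^ 2 ≤ 2 * e ^ 2 + 8 * ξ ^ 2`, the rest is at most `32 * c * ξ ^ 2 ≤
ξ`. -/
lemma heavyFraction_succ {K ξ : ℝ} {j : ℕ} (hK : 1 ≤ K) (hξ : 0 ≤ ξ)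
    (h : 32 * (K * 2 ^ j) * ξ ≤ 1) :
    4 * (K * 2 ^ j) * heavyFraction K ξ j ^ 2 + ξ ≤ heavyFraction K ξ (j + 1) := by
  have hc : 0 < K * 2 ^ j := by positivity
  have e1 : heavyFraction K ξ (j + 1) =
      8 * (K * 2 ^ j) * ((1 / 2) ^ (2 ^ j) / (16 * (K * 2 ^ j))) ^ 2 + 2 * ξ := by
    rw [heavyFraction, pow_succ 2 j, pow_mul, pow_succ]
    field_simp
    ring
  rw [e1, heavyFraction]
  set e := (1 / 2 : ℝ) ^ (2 ^ j) / (16 * (K * 2 ^ j))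
  have h1 : 32 * (K * 2 ^ j) * ξ * ξ ≤ 1 * ξ := mul_le_mul_of_nonneg_right h hξ
  have h2 : 0 ≤ 4 * (K * 2 ^ j) * (e - 2 * ξ) ^ 2 := by positivity
  nlinarith

variable {V Ω : Type*} [MeasurableSpace Ω] [MeasurableSpace V] [DiscreteMeasurableSpace V]
  [Fintype V] {μ : Measure Ω} [IsProbabilityMeasure μ] {W₁ W₂ : ℕ → Ω → V} {M : ℕ} {δ : ℝ}

open Classical in
-- The induction starts from the pigeonhole bound: at most `n / i₀ ≤ n / (32 * K)` bins have `i₀`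
-- balls, and `1 / (32 * K)` is the main term of `heavyFraction` at `0`.
lemma card_heavyBins_le_heavyFraction {tie : TieRule V} {w₁ w₂ : ℕ → V} {K ξ n a : ℝ}
    {i₀ J T : ℕ} (hn : n = T) (hn0 : 0 < n) (hK : 1 ≤ K) (hξ : 0 ≤ ξ)
    (hi₀ : 32 * K ≤ i₀) (hJ : 32 * (K * 2 ^ J) * ξ ≤ 1) (ha : M + a ≤ n * ξ)
    (h1 : (((Finset.range T).filter fun u => RecentHit M u w₁ w₂).card : ℝ) < a)
    (h2 : ∀ j < J, (((Finset.range T).filter fun u => BothHit (heavyBins tie (i₀ + j))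
      (n * heavyFraction K ξ j) M u w₁ w₂).card : ℝ) <
        n * (4 * (K * 2 ^ j) * heavyFraction K ξ j ^ 2)) {j : ℕ} (hj : j ≤ J) :
    ((heavyBins tie (i₀ + j) T w₁ w₂).card : ℝ) ≤ n * heavyFraction K ξ j := by
  induction j with
  | zero =>
    have h := mul_card_heavyBins_le (tie := tie) (w₁ := w₁) (w₂ := w₂) i₀ T
    have h' : (i₀ : ℝ) * (heavyBins tie i₀ T w₁ w₂).card ≤ n := by rw [hn]; exact_mod_cast h
    have h3 : 32 * K * (heavyBins tie i₀ T w₁ w₂).card ≤ n :=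
      (mul_le_mul_of_nonneg_right hi₀ (Nat.cast_nonneg _)).trans h'
    rw [heavyFraction, add_zero]
    have h4 : n * (1 / (32 * K)) ≤ n * ((1 / 2) ^ (2 ^ 0) / (16 * (K * 2 ^ 0)) + 2 * ξ) := by
      refine mul_le_mul_of_nonneg_left ?_ hn0.le
      have : (1 / 2 : ℝ) ^ (2 ^ 0) / (16 * (K * 2 ^ 0)) = 1 / (32 * K) := by
        field_simp; norm_num
      rw [this]; linarith
    refine le_trans ?_ h4
    rw [mul_one_div, le_div_iff₀ (by positivity)]
    linarith
  | succ j ih =>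
    have h3 := card_heavyBins_succ_le (M := M) (ih (by omega))
    have h4 : ((heavyBins tie (i₀ + j + 1) T w₁ w₂).card : ℝ) ≤ M +
        ((Finset.range T).filter fun u => RecentHit M u w₁ w₂).card +
        ((Finset.range T).filter fun u => BothHit (heavyBins tie (i₀ + j))
          (n * heavyFraction K ξ j) M u w₁ w₂).card := by exact_mod_cast h3
    have h5 := h2 j (by omega)
    have h6 : 32 * (K * 2 ^ j) * ξ ≤ 1 := by
      refine le_trans ?_ hJ
      gcongr
      · norm_num
      · omega
    have h7 := mul_le_mul_of_nonneg_left (heavyFraction_succ hK hξ h6) hn0.le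
    rw [← add_assoc]
    linarith

/-- Three kinds of failure: too many recent hits (`1 / K`), too many double hits at some level (`2 /
K` in all), and a hit chain of length `r` for either walk above level `i₀ + J`. -/
lemma WalkPair.prob_maxLoad_gt_le (tie : TieRule V)
    (h : WalkPair μ W₁ W₂ M (2 / Fintype.card V) δ) (hδ : 0 ≤ δ) (hM : 1 ≤ M)
    (hV : 0 < Fintype.card V) {K ξ : ℝ} {i₀ J r : ℕ} (hK : 1 ≤ K)
    (hξ : ξ = (1 + 4 * K) * (M * (δ + 2 / Fintype.card V)))
    (hi₀ : 32 * K ≤ i₀) (hJ : 32 * (K * 2 ^ J) * ξ ≤ 1) (hnJ : Fintype.card V ≤ 2 ^ 2 ^ J) :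
    pairProb μ W₁ W₂ (fun w₁ w₂ => i₀ + J + 2 * r < maxLoad tie w₁ w₂) ≤
      3 / K + 2 * ((15 * ξ) ^ r * Fintype.card V) := by
  classical
  set T := Fintype.card V with hT
  have hn0 : (0 : ℝ) < T := by exact_mod_cast hV
  set n : ℝ := (T : ℝ) with hn
  have hMR : (1 : ℝ) ≤ M := by exact_mod_cast hM
  set δ₁ := M * (δ + 2 / n) with hδ₁
  have hq : 0 ≤ 2 / n := by positivity
  have hδ₁0 : 0 < δ₁ := by positivity
  have hMδ : M * δ ≤ δ₁ := by
    rw [hδ₁, mul_add]; linarith [mul_nonneg (zero_le_one.trans hMR) hq]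
  have hMn : M * (2 / n) ≤ δ₁ := by
    rw [hδ₁, mul_add]; linarith [mul_nonneg (zero_le_one.trans hMR) hδ]
  have hMn' : (M : ℝ) ≤ n * δ₁ := by
    have := mul_le_mul_of_nonneg_left hMn hn0.le
    have e : n * (M * (2 / n)) = 2 * M := by field_simp
    linarith
  have hξ0 : 0 < ξ := by rw [hξ]; positivity
  have hδξ : δ₁ ≤ ξ := by rw [hξ]; nlinarith
  set y := heavyFraction K ξ with hy
  have hy0 : ∀ j, 0 < y j := fun j => by
    rw [hy, heavyFraction]; positivity
  -- By level `J` the repeated squaring has brought the main term below `1 / n ≤ ξ`.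
  have hyJ : y J ≤ 3 * ξ := by
    have h1 : (1 / 2 : ℝ) ^ (2 ^ J) ≤ 1 / n := by
      rw [div_pow, one_pow]
      exact one_div_le_one_div_of_le hn0 (by rw [hn]; exact_mod_cast hnJ)
    have h2 : 1 / n ≤ ξ := by
      have : 1 / n ≤ M * (2 / n) := by
        rw [mul_div_assoc']
        gcongr
        linarith
      linarith
    have h3 : (1 / 2 : ℝ) ^ (2 ^ J) / (16 * (K * 2 ^ J)) ≤ (1 / 2 : ℝ) ^ (2 ^ J) := by
      refine div_le_self (by positivity) ?_
      have : (1 : ℝ) ≤ 2 ^ J := one_le_pow₀ (by norm_num)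
      nlinarith
    rw [hy, heavyFraction]
    linarith
  set β := n * (3 * ξ) with hβ
  have hβ0 : 0 ≤ β := by positivity
  set RB : (ℕ → V) → (ℕ → V) → Prop := fun w₁ w₂ =>
    n * (4 * K * δ₁) ≤ (((Finset.range T).filter fun u => RecentHit M u w₁ w₂).card : ℝ) with hRB
  set BB : ℕ → (ℕ → V) → (ℕ → V) → Prop := fun j w₁ w₂ => n * (4 * (K * 2 ^ j) * y j ^ 2) ≤
    (((Finset.range T).filter fun u => BothHit (heavyBins tie (i₀ + j)) (n * y j) M u w₁ w₂).card
      : ℝ) with hBB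
  set C₁ : (ℕ → V) → (ℕ → V) → Prop := fun w₁ w₂ =>
    ∃ v, ∃ t < T, HitChain (heavyBins tie (i₀ + J)) β r v t w₁ w₂ with hC₁
  set C₂ : (ℕ → V) → (ℕ → V) → Prop := fun w₁ w₂ =>
    ∃ v, ∃ t < T, HitChain (fun t w₁ w₂ => heavyBins tie (i₀ + J) t w₂ w₁) β r v t w₁ w₂ with hC₂
  have hincl : ∀ w₁ w₂, i₀ + J + 2 * r < maxLoad tie w₁ w₂ →
      (RB w₁ w₂ ∨ ∃ j ∈ Finset.range J, BB j w₁ w₂) ∨ (C₁ w₁ w₂ ∨ C₂ w₂ w₁) := by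
    intro w₁ w₂ hw
    by_contra! hcon
    obtain ⟨⟨hR, hB⟩, hc1, hc2⟩ := hcon
    have hheavy := card_heavyBins_le_heavyFraction (tie := tie) (w₁ := w₁) (w₂ := w₂) (M := M) hn
      hn0 hK hξ0.le hi₀ hJ (a := n * (4 * K * δ₁)) (by rw [hξ]; linarith) (not_le.1 hR)
      (fun j hj => not_le.1 (hB j (Finset.mem_range.2 hj))) le_rfl
    have hheavy' := hheavy.trans (mul_le_mul_of_nonneg_left hyJ hn0.le)
    obtain ⟨v, -, hv⟩ := Finset.lt_sup_iff.1 hw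
    rcases exists_hitChain_of_lt_load hheavy' hv with ⟨t, ht, hc⟩ | ⟨t, ht, hc⟩
    · exact hc1 ⟨v, t, ht, hc⟩
    · exact hc2 ⟨v, t, ht, hc⟩
  have pR : pairProb μ W₁ W₂ RB ≤ 1 / K := by
    have := h.prob_card_recentHit_ge_le hq hδ T (n * (4 * K * δ₁))
    have e : (T : ℝ) * (2 * (Fintype.card V * (2 / n * (M * (δ + 2 / n))))) = n * (4 * δ₁) := by
      rw [← hT, ← hn, ← hδ₁]; field_simp; norm_num
    rw [e] at this
    rw [le_div_iff₀ (by linarith)]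
    refine le_of_mul_le_mul_left ?_ (by positivity : 0 < n * (4 * δ₁))
    linarith
  -- The threshold at level `j` is `K * 2 ^ j` times the bound on the mean, so Markov's inequality
  -- gives a summable series.
  have pB : ∀ j, pairProb μ W₁ W₂ (BB j) ≤ 1 / K * (1 / 2) ^ j := fun j => by
    have := h.prob_card_bothHit_ge_le hq (mul_nonneg hn0.le (hy0 j).le)
      (growingSet_heavyBins tie (i₀ + j)) T (n * (4 * (K * 2 ^ j) * y j ^ 2))
    have e : (T : ℝ) * (2 / n * (n * y j)) ^ 2 = n * (4 * y j ^ 2) := by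
      rw [← hn]; field_simp; ring
    rw [e] at this
    have e2 : 1 / K * (1 / 2 : ℝ) ^ j = 1 / (K * 2 ^ j) := by
      rw [div_pow, one_pow]; field_simp
    rw [e2, le_div_iff₀ (by positivity)]
    have := hy0 j
    refine le_of_mul_le_mul_left ?_ (by positivity : 0 < n * (4 * y j ^ 2))
    linarith
  have pBs : pairProb μ W₁ W₂ (fun w₁ w₂ => ∃ j ∈ Finset.range J, BB j w₁ w₂) ≤ 2 / K := by
    refine (pairProb_le_sum _ fun _ _ h => h).trans ((Finset.sum_le_sum fun j _ => pB j).trans ?_)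
    rw [← Finset.mul_sum]
    have hgeo : ∑ j ∈ Finset.range J, (1 / 2 : ℝ) ^ j ≤ 2 := by
      have := summable_geometric_two.sum_le_tsum (Finset.range J) fun j _ => by positivity
      rwa [tsum_geometric_two] at this
    calc 1 / K * ∑ j ∈ Finset.range J, (1 / 2 : ℝ) ^ j ≤ 1 / K * 2 :=
          mul_le_mul_of_nonneg_left hgeo (by positivity)
      _ = 2 / K := by ring
  -- The constant is `15 = 1 + 12 + 2`: early returns, the heavy set of size `3 * ξ * n`, and recent
  -- visits.
  have hD : M * δ + T * (2 / n * (2 / n * β) + 2 / n * (M * (δ + 2 / n))) ≤ 15 * ξ := by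
    have e : M * δ + T * (2 / n * (2 / n * β) + 2 / n * (M * (δ + 2 / n))) =
        M * δ + 12 * ξ + 2 * δ₁ := by
      rw [← hδ₁, ← hn, hβ]; field_simp; ring
    rw [e]; linarith
  have hD0 : 0 ≤ M * δ + T * (2 / n * (2 / n * β) + 2 / n * (M * (δ + 2 / n))) := by positivity
  have hpow := mul_le_mul_of_nonneg_right (pow_le_pow_left₀ hD0 hD r) hn0.le
  have pC₁ : pairProb μ W₁ W₂ C₁ ≤ (15 * ξ) ^ r * n :=
    (h.prob_exists_hitChain_le hq hδ hβ0 (growingSet_heavyBins tie (i₀ + J)) r T).trans hpow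
  have pC₂ : pairProb μ W₂ W₁ C₂ ≤ (15 * ξ) ^ r * n :=
    (h.swap.prob_exists_hitChain_le hq hδ hβ0 (growingSet_heavyBins tie (i₀ + J)).swap r T).trans
      hpow
  have t1 := pairProb_le_add (μ := μ) (W₁ := W₁) (W₂ := W₂) hincl
  have t2 := pairProb_le_add (μ := μ) (W₁ := W₁) (W₂ := W₂) (B := RB)
    (C := fun w₁ w₂ => ∃ j ∈ Finset.range J, BB j w₁ w₂) fun _ _ h => h
  have t3 := pairProb_le_add (μ := μ) (W₁ := W₁) (W₂ := W₂) (B := C₁)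
    (C := fun w₁ w₂ => C₂ w₂ w₁) fun _ _ h => h
  have t4 : pairProb μ W₁ W₂ (fun w₁ w₂ => C₂ w₂ w₁) = pairProb μ W₂ W₁ C₂ := pairProb_swap
  have e3 : 3 / K = 1 / K + 2 / K := by ring
  linarith

end MaxLoad

/-! ### Choice of the parameters -/

section Asymptotics

lemma tendsto_log_natCast : Tendsto (fun n : ℕ => Real.log n) atTop atTop :=
  Real.tendsto_log_atTop.comp tendsto_natCast_atTop_atTop

/-- Taking logarithms and writing `y = log log n`, this says that `(log B + y) * y` is eventually at
most `a * exp y`. -/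
lemma eventually_mul_log_le_exp {a B : ℝ} (ha : 0 < a) (hB : 0 < B) :
    ∀ᶠ n : ℕ in atTop, B * Real.log n ≤ Real.exp (a * (Real.log n / Real.log (Real.log n))) := by
  have h1 : ∀ᶠ y : ℝ in atTop, (Real.log B + y) * y ≤ a * Real.exp y := by
    have h := (Real.tendsto_pow_mul_exp_neg_atTop_nhds_zero 2).eventually
      (gt_mem_nhds (show (0 : ℝ) < a / 2 by positivity))
    filter_upwards [h, eventually_ge_atTop (Real.log B), eventually_ge_atTop 0] with y hy hyB hy0
    rw [Real.exp_neg, ← div_eq_mul_inv, div_lt_iff₀ (Real.exp_pos y)] at hy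
    nlinarith
  filter_upwards [(Real.tendsto_log_atTop.comp tendsto_log_natCast).eventually h1,
    (Real.tendsto_log_atTop.comp tendsto_log_natCast).eventually_gt_atTop 0,
    tendsto_log_natCast.eventually_gt_atTop 0] with n h hy hL
  simp only [Function.comp_apply] at h hy
  rw [Real.exp_log hL] at h
  rw [← Real.log_le_iff_le_exp (by positivity), Real.log_mul hB.ne' hL.ne', mul_div_assoc',
    le_div_iff₀ hy]
  exact h

lemma eventually_exists_parameters {α K θ ε : ℝ} (hα : 0 < α) (hK : 1 ≤ K) (hθ0 : 0 < θ)
    (hθ1 : θ < 1) (hε : 0 < ε) (k i₀ : ℕ) :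
    ∀ᶠ n : ℕ in atTop, ∃ (m J r : ℕ) (ξ : ℝ), θ ^ m * k ≤ (1 / (n : ℝ)) ^ 2 ∧
      ξ = (1 + 4 * K) * (((2 * m + 1 : ℕ) : ℝ) *
        ((1 / 2) ^ ⌈α * Real.log n / Real.log (Real.log n)⌉₊ + 2 / n)) ∧
      32 * (K * 2 ^ J) * ξ ≤ 1 ∧ n ≤ 2 ^ 2 ^ J ∧ 2 * ((15 * ξ) ^ r * n) ≤ ε ∧
      ((i₀ + J + 2 * r : ℕ) : ℝ) < (2 + 16 / α) * Real.logb 2 (Real.log n) := by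
  have hl2 : 0 < Real.log 2 := Real.log_pos one_lt_two
  set c := α * Real.log 2 with hc
  have hc0 : 0 < c := by positivity
  set b := -Real.log θ with hb
  have hb0 : 0 < b := neg_pos.2 (Real.log_neg hθ0 hθ1)
  set C := 6 / b + 3 with hC
  have hC0 : 0 < C := by positivity
  have hLL := Real.tendsto_log_atTop.comp tendsto_log_natCast
  filter_upwards [eventually_mul_log_le_exp (a := 3 * c / 4) (B := 45 * (1 + 4 * K) * C)
      (by positivity) (by positivity),
    eventually_mul_log_le_exp (a := c / 4) (B := 32 * K * 4) (by positivity) (by positivity),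
    tendsto_log_natCast.eventually_ge_atTop 1, hLL.eventually_ge_atTop c,
    hLL.eventually_ge_atTop (Real.log 2 * (i₀ + 5)),
    tendsto_natCast_atTop_atTop.eventually_ge_atTop (2 / ε : ℝ),
    tendsto_natCast_atTop_atTop.eventually_ge_atTop (k : ℝ),
    eventually_ge_atTop 1] with n h1 h2 hL1 hLLc hLLi hnε hnk hn1
  simp only [Function.comp_apply] at hLLc hLLi
  set L := Real.log n with hL
  set Y := Real.log L with hY
  have hn0 : (0 : ℝ) < n := by exact_mod_cast hn1
  have hL0 : 0 < L := by linarith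
  have hY0 : 0 < Y := lt_of_lt_of_le hc0 hLLc
  have hexpL : Real.exp L = n := Real.exp_log hn0
  have hexpY : Real.exp Y = L := Real.exp_log hL0
  -- Gives `θ ^ m ≤ n ^ (-3)`; one power of `n` absorbs the factor `k`.
  set m := ⌈3 / b * L⌉₊ with hm
  -- Large enough for `2 ^ 2 ^ J ≥ n`, yet `2 ^ J` is still only `O(log n)`.
  set J := ⌈Real.logb 2 (2 * L)⌉₊ with hJ
  -- Makes `(15 * ξ) ^ r ≤ n ^ (-2)`, given `15 * ξ ≤ exp (-(c / 4) * L / Y)`.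
  set r := ⌈8 / c * Y⌉₊ with hr
  have hm1 : 3 / b * L ≤ m := Nat.le_ceil _
  have hm2 : (m : ℝ) < 3 / b * L + 1 := Nat.ceil_lt_add_one (by positivity)
  have hr1 : 8 / c * Y ≤ r := Nat.le_ceil _
  have hr2 : (r : ℝ) < 8 / c * Y + 1 := Nat.ceil_lt_add_one (by positivity)
  have hlogb0 : 0 ≤ Real.logb 2 (2 * L) := Real.logb_nonneg one_lt_two (by linarith)
  have hJ1 : Real.logb 2 (2 * L) ≤ J := Nat.le_ceil _
  have hJ2 : (J : ℝ) < Real.logb 2 (2 * L) + 1 := Nat.ceil_lt_add_one hlogb0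
  have hJ3 : 2 * L ≤ (2 : ℝ) ^ J := by
    rw [← Real.rpow_natCast]
    exact (Real.logb_le_iff_le_rpow one_lt_two (by linarith)).1 hJ1
  have hJ4 : (2 : ℝ) ^ J ≤ 4 * L := by
    rw [← Real.rpow_natCast]
    refine (Real.rpow_le_rpow_of_exponent_le one_le_two hJ2.le).trans_eq ?_
    rw [Real.rpow_add two_pos, Real.rpow_logb two_pos (by norm_num) (by linarith), Real.rpow_one]
    ring
  set ρ := ⌈α * L / Y⌉₊ with hρ
  set ξ := (1 + 4 * K) * (((2 * m + 1 : ℕ) : ℝ) * ((1 / 2) ^ ρ + 2 / n)) with hξ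
  have hξ0 : 0 < ξ := by positivity
  have hM : ((2 * m + 1 : ℕ) : ℝ) ≤ C * L := by
    push_cast
    have : C * L = 2 * (3 / b * L) + 3 * L := by rw [hC]; ring
    linarith
  have hδ : (1 / 2 : ℝ) ^ ρ ≤ Real.exp (-(c * (L / Y))) := by
    have e : (1 / 2 : ℝ) ^ ρ = Real.exp (-(ρ * Real.log 2)) := by
      rw [Real.exp_neg, Real.exp_nat_mul, Real.exp_log two_pos, one_div, inv_pow]
    rw [e, Real.exp_le_exp, neg_le_neg_iff]
    have : α * L / Y ≤ ρ := Nat.le_ceil _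
    calc c * (L / Y) = α * L / Y * Real.log 2 := by rw [hc]; ring
      _ ≤ ρ * Real.log 2 := mul_le_mul_of_nonneg_right this hl2.le
  have hn2 : 2 / (n : ℝ) ≤ 2 * Real.exp (-(c * (L / Y))) := by
    rw [← hexpL, div_eq_mul_inv, ← Real.exp_neg]
    refine mul_le_mul_of_nonneg_left (Real.exp_le_exp.2 (neg_le_neg ?_)) two_pos.le
    rw [mul_div_assoc', div_le_iff₀ hY0, mul_comm]
    exact mul_le_mul_of_nonneg_left hLLc hL0.le
  -- Three quarters of the exponent `c * L / Y` absorb the factor of order `log n`; one quarter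
  -- survives.
  have hξ1 : 15 * ξ ≤ Real.exp (-(c / 4 * (L / Y))) := by
    calc 15 * ξ ≤ 15 * ((1 + 4 * K) * ((C * L) * (3 * Real.exp (-(c * (L / Y)))))) := by
          rw [hξ]
          have : (1 / 2 : ℝ) ^ ρ + 2 / n ≤ 3 * Real.exp (-(c * (L / Y))) := by linarith
          gcongr
      _ = 45 * (1 + 4 * K) * C * L * Real.exp (-(c * (L / Y))) := by ring
      _ ≤ Real.exp (3 * c / 4 * (L / Y)) * Real.exp (-(c * (L / Y))) :=
          mul_le_mul_of_nonneg_right h1 (Real.exp_pos _).le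
      _ = Real.exp (-(c / 4 * (L / Y))) := by rw [← Real.exp_add]; ring_nf
  refine ⟨m, J, r, ξ, ?_, rfl, ?_, ?_, ?_, ?_⟩
  · have e : θ ^ m = Real.exp (-(m * b)) := by
      rw [hb, mul_neg, neg_neg, Real.exp_nat_mul, Real.exp_log hθ0]
    have h3 : 3 * L ≤ m * b := by
      have := mul_le_mul_of_nonneg_right hm1 hb0.le
      refine le_trans (le_of_eq ?_) this
      field_simp
    calc θ ^ m * k ≤ Real.exp (-(3 * L)) * n := by
          rw [e]
          exact mul_le_mul (Real.exp_le_exp.2 (neg_le_neg h3)) hnk (Nat.cast_nonneg k)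
            (Real.exp_pos _).le
      _ = (1 / (n : ℝ)) ^ 2 := by
          rw [Real.exp_neg, show (3 : ℝ) * L = (3 : ℕ) * L by norm_num, Real.exp_nat_mul, hexpL]
          field_simp
  · calc 32 * (K * 2 ^ J) * ξ ≤ 32 * (K * (4 * L)) * (15 * ξ) := by
          have : ξ ≤ 15 * ξ := by linarith
          gcongr
      _ ≤ 32 * (K * (4 * L)) * Real.exp (-(c / 4 * (L / Y))) := by gcongr
      _ = 32 * K * 4 * L * Real.exp (-(c / 4 * (L / Y))) := by ring
      _ ≤ Real.exp (c / 4 * (L / Y)) * Real.exp (-(c / 4 * (L / Y))) :=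
          mul_le_mul_of_nonneg_right h2 (Real.exp_pos _).le
      _ = 1 := by rw [← Real.exp_add, add_neg_cancel, Real.exp_zero]
  · have h3 : (n : ℝ) ≤ 2 ^ 2 ^ J := by
      rw [← hexpL]
      have e : (2 : ℝ) ^ 2 ^ J = Real.exp ((2 ^ J : ℕ) * Real.log 2) := by
        rw [Real.exp_nat_mul, Real.exp_log two_pos]
      rw [e, Real.exp_le_exp]
      push_cast
      have : (1 : ℝ) / 2 ≤ Real.log 2 := by linarith [Real.log_two_gt_d9]
      nlinarith
    exact_mod_cast h3
  · have h3 : (15 * ξ) ^ r ≤ Real.exp (-(2 * L)) := by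
      refine (pow_le_pow_left₀ (by positivity) hξ1 r).trans ?_
      rw [← Real.exp_nat_mul, Real.exp_le_exp, mul_neg, neg_le_neg_iff]
      calc 2 * L = 8 / c * Y * (c / 4 * (L / Y)) := by field_simp; norm_num
        _ ≤ r * (c / 4 * (L / Y)) := mul_le_mul_of_nonneg_right hr1 (by positivity)
    have h4 : (15 * ξ) ^ r * n ≤ 1 / n := by
      refine (mul_le_mul_of_nonneg_right h3 hn0.le).trans_eq ?_
      rw [Real.exp_neg, show (2 : ℝ) * L = (2 : ℕ) * L by norm_num, Real.exp_nat_mul, hexpL]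
      field_simp
    have h5 : 2 / (n : ℝ) ≤ ε := by
      rw [div_le_iff₀ hn0]
      rwa [div_le_iff₀ hε, mul_comm] at hnε
    calc 2 * ((15 * ξ) ^ r * n) ≤ 2 * (1 / n) := by linarith
      _ = 2 / n := by ring
      _ ≤ ε := h5
  · have e1 : Real.logb 2 (2 * L) = 1 + Real.logb 2 L := by
      rw [Real.logb_mul two_ne_zero hL0.ne', Real.logb_self_eq_one one_lt_two]
    have e2 : Y = Real.log 2 * Real.logb 2 L := by
      rw [Real.logb, hY]; field_simp
    have e3 : 8 / c * Y = 8 / α * Real.logb 2 L := by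
      rw [e2, hc]; field_simp
    have h6 : (i₀ : ℝ) + 5 ≤ Real.logb 2 L := by
      rw [e2] at hLLi
      exact le_of_mul_le_mul_left hLLi hl2
    push_cast
    rw [e3] at hr2
    rw [e1] at hJ2
    -- One `logb` comes from `J`, `16 / α` of them from `2 * r`; the remaining one absorbs `i₀` and
    -- the roundings.
    have e4 : (2 + 16 / α) * Real.logb 2 L =
        2 * Real.logb 2 L + 2 * (8 / α * Real.logb 2 L) := by ring
    rw [e4]
    linarith

end Asymptotics

/-! ### From expander sequences to uniform spectral bounds -/

section Expanders

variable {k : ℕ} {lam : ℝ} {I : Set ℕ} {G : (n : ℕ) → SimpleGraph (Fin n)}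

lemma IsExpanderSequence.eventually_spectralBound (h : IsExpanderSequence k lam I G) :
    ∃ σ : ℝ, 0 ≤ σ ∧ σ < k ∧ ∀ᶠ n in atTop, n ∈ I →
      (∀ a, ∑ b, adjWeight (G n) a b = k) ∧ SpectralBound (G n) σ := by
  have hne : (atTop ⊓ 𝓟 I : Filter ℕ).NeBot := by
    rw [← frequently_mem_iff_neBot, Nat.frequently_atTop_iff_infinite]
    exact h.infinite
  have hreg : ∀ n ∈ I, ∀ a, ∑ b, adjWeight (G n) a b = k := fun n hn a => by
    classical
    exact sum_adjWeight_of_regular (h.regular n hn) a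
  have hlt : limsup (fun n => secondEigenvalue (G n)) (atTop ⊓ 𝓟 I) < (lam + k) / 2 := by
    rw [h.limsup_eq]; linarith [h.lt_degree]
  -- A real `limsup` controls the sequence eventually only if the sequence is bounded above.
  have hbdd : IsBoundedUnder (· ≤ ·) (atTop ⊓ 𝓟 I) fun n => secondEigenvalue (G n) :=
    isBoundedUnder_of_eventually_le (a := (k : ℝ)) (eventually_inf_principal.2
      (Eventually.of_forall fun n hn => secondEigenvalue_le (hreg n hn)))
  have hev := eventually_lt_of_limsup_lt hlt hbdd
  obtain ⟨n₀, hn₀⟩ := hev.exists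
  have hσk : (lam + k) / 2 < k := by linarith [h.lt_degree]
  refine ⟨(lam + k) / 2, ((secondEigenvalue_nonneg _).trans_lt hn₀).le, hσk, ?_⟩
  filter_upwards [eventually_inf_principal.1 hev, eventually_ge_atTop 2] with n hn hn2 hnI
  exact ⟨hreg n hnI, spectralBound_of_secondEigenvalue_le (hreg n hnI) (by simpa using hn2)
    (hn hnI).le hσk⟩

/-- Degree 1 or 2 would bound the number of vertices, although `I` is infinite; degree 0 is excluded
by `0 ≤ σ < k`. -/
lemma IsExpanderSequence.three_le (h : IsExpanderSequence k lam I G) : 3 ≤ k := by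
  obtain ⟨σ, hσ0, hσk, hev⟩ := h.eventually_spectralBound
  by_contra! hk
  have hk1 : 1 ≤ k := by
    have : (0 : ℝ) < k := lt_of_le_of_lt hσ0 hσk
    exact_mod_cast this
  obtain ⟨N, hN⟩ := exists_card_le_of_spectralBound hk1 (by omega) hσ0 hσk
  obtain ⟨n, hnI, hn, hnN⟩ := ((Nat.frequently_atTop_iff_infinite.2 h.infinite).and_eventually
    (hev.and (eventually_gt_atTop N))).exists
  have := hN (hn hnI).1 (hn hnI).2
  rw [Fintype.card_fin] at this
  omega

lemma WalkBounds.mono {V Ω : Type*} [MeasurableSpace V] [MeasurableSpace Ω] {μ : Measure Ω}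
    {W : ℕ → Ω → V} {M : ℕ} {q δ δ' : ℝ} (h : WalkBounds μ W M q δ) (hδ : δ ≤ δ') :
    WalkBounds μ W M q δ' where
  measurable := h.measurable
  mixing := h.mixing
  return_le t p s hs := (h.return_le t p s hs).trans
    (mul_le_mul_of_nonneg_right hδ measureReal_nonneg)

end Expanders

/-! ### Assembly of the main theorem -/

theorem mainTheorem4 (k : ℕ) (lam α : ℝ) (hα : 0 < α) :
    ∃ κ : ℝ, 0 < κ ∧ ∃ C : ℝ,
      ∀ (I : Set ℕ) (G : (n : ℕ) → SimpleGraph (Fin n)),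
        IsExpanderSequence k lam I G →
        (∀ n ∈ I, ((2 * ⌈α * Real.log n / Real.log (Real.log n)⌉₊ + 1 : ℕ) : ℕ∞) ≤ (G n).egirth) →
        ∀ ε : ℝ, 0 < ε → ∀ᶠ n in atTop, n ∈ I →
          ∀ (tie : TieRule (Fin n)) (Ω : Type*) (_ : MeasurableSpace Ω) (μ : Measure Ω)
            (_ : IsProbabilityMeasure μ) (W₁ W₂ : ℕ → Ω → Fin n),
            IsNonBacktrackingWalk (G n) μ W₁ →
            IsNonBacktrackingWalk (G n) μ W₂ →
            IndepFun (fun ω t => W₁ t ω) (fun ω t => W₂ t ω) μ →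
            1 - ε ≤ μ.real {ω | (maxLoad tie (fun t => W₁ t ω) (fun t => W₂ t ω) : ℝ) <
              κ * Real.logb 2 (Real.log n) + C} := by
  -- Neither constant depends on `ε`: its influence through `i₀ = ⌈32 * K⌉₊` is absorbed by `logb`
  -- for large `n`, so `C = 0` works.
  refine ⟨2 + 16 / α, by positivity, 0, fun I G hG hgirth ε hε => ?_⟩
  have hk3 := hG.three_le
  obtain ⟨σ, hσ0, hσk, hev⟩ := hG.eventually_spectralBound
  obtain ⟨θ, hθ0, hθ1, hmix⟩ := exists_nbProb_le hk3 hσ0 hσk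
  -- The Markov failures `3 / K` take half of `ε`, the hit chains the other half.
  set K := max 1 (6 / ε) with hK
  have hK1 : 1 ≤ K := le_max_left _ _
  have hKε : 3 / K ≤ ε / 2 := by
    have : 6 / ε ≤ K := le_max_right _ _
    rw [div_le_iff₀ hε] at this
    rw [div_le_iff₀ (by linarith)]
    linarith
  filter_upwards [hev, eventually_exists_parameters hα hK1 hθ0 hθ1 (half_pos hε) k ⌈32 * K⌉₊,
    eventually_ge_atTop 1] with n hn hpar hn1 hnI tie Ω _ μ _ W₁ W₂ h₁ h₂ hind
  obtain ⟨hreg, hspec⟩ := hn hnI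
  obtain ⟨m, J, r, ξ, hm, hξ, hJ, hnJ, hr, hfin⟩ := hpar
  set ρ := ⌈α * Real.log n / Real.log (Real.log n)⌉₊ with hρ
  have hcard : Fintype.card (Fin n) = n := Fintype.card_fin n
  have hδ : (((k : ℝ) - 1)⁻¹) ^ ρ ≤ (1 / 2) ^ ρ := by
    have hk : (3 : ℝ) ≤ k := by exact_mod_cast hk3
    rw [one_div]
    exact pow_le_pow_left₀ (inv_nonneg.2 (by linarith)) (inv_anti₀ two_pos (by linarith)) ρ
  have hq := hmix hreg hspec m (by rw [hcard]; exact hm)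
  have hpair : WalkPair μ W₁ W₂ (2 * m + 1) (2 / Fintype.card (Fin n)) ((1 / 2) ^ ρ) :=
    ⟨(h₁.walkBounds hreg (by omega) hq (hgirth n hnI)).mono hδ,
      (h₂.walkBounds hreg (by omega) hq (hgirth n hnI)).mono hδ, hind⟩
  have hbad := hpair.prob_maxLoad_gt_le tie (by positivity) (by omega) (by omega) hK1
    (by rw [hcard]; exact hξ) (Nat.le_ceil (32 * K)) hJ (by rw [hcard]; exact hnJ) (r := r)
  rw [hcard] at hbad
  set good := {ω | (maxLoad tie (fun t => W₁ t ω) (fun t => W₂ t ω) : ℝ) <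
    (2 + 16 / α) * Real.logb 2 (Real.log n) + 0}
  -- Subadditivity over this cover avoids any measurability of `good`.
  have hcover : (Set.univ : Set Ω) ⊆ good ∪ pairEvent W₁ W₂
      (fun w₁ w₂ => ⌈32 * K⌉₊ + J + 2 * r < maxLoad tie w₁ w₂) := fun ω _ => by
    by_cases hω : ⌈32 * K⌉₊ + J + 2 * r < maxLoad tie (fun t => W₁ t ω) fun t => W₂ t ω
    · exact .inr hω
    · left
      change (maxLoad tie (fun t => W₁ t ω) (fun t => W₂ t ω) : ℝ) < _
      rw [add_zero]
      exact lt_of_le_of_lt (by exact_mod_cast not_lt.1 hω) hfin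
  have h3 := (measureReal_mono hcover (measure_ne_top μ _)).trans (measureReal_union_le _ _)
  rw [probReal_univ] at h3
  have h4 : μ.real (pairEvent W₁ W₂
      (fun w₁ w₂ => ⌈32 * K⌉₊ + J + 2 * r < maxLoad tie w₁ w₂)) ≤ ε :=
    hbad.trans (by linarith)
  linarith
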